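/- Let $d\ge 0$, $A=\mathbb{Q}[x_1,\dots,x_d]/\mathfrak{m}^2$ with $\mathfrak{m}=(x_1,\dots,x_d)$, and let all tensor products be over $\mathbb{Q}$. On $A^{\otimes q+1}$ let $$b(a_0\otimes\cdots\otimes a_q)=\sum_{i=0}^{q-1}(-1)^i a_0\otimes\cdots\otimes a_ia_{i+1}\otimes\cdots\otimes a_q+(-1)^q a_qa_0\otimes a_1\otimes\cdots\otimes a_{q-1},$$ let $b'$ be the same sum without its last term, let $t(a_0\otimes\cdots\otimes a_q)=(-1)^q a_q\otimes a_0\otimes\cdots\otimes a_{q-1}$ and $N=1+t+\cdots+t^q$. The negative cyclic homology $HC^-_*(A)$ is the homology of the (product) total complex of the second quadrant double complex with entry $A^{\otimes q+1}$ in column $p\le 0$ and row $q\ge 0$, with vertical maps $b$ in even columns and $-b'$ in odd columns, and with horizontal maps $N$ out of even columns and $1-t$ out of odd columns. The weight of a tensor monomial is the total number of $x_i$'s in it; all these maps preserve weight, and $(HC^-)^{(w)}_n(A)$ denotes the degree $n$ homology of the weight $w$ part of the complex (the product total complex of the weight $w$ parts of the entries). Let $\omega_{m,d}$ be the set of cycle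 families (orbits under cyclic rotation) of words of length $m$ in $x_1,\dots,x_d$ whose cycle length is $m$, where the cycle length of a word is the smallest $l>0$ such that rotating the word $l$ times does not change it. Then for $w=0$ $$(HC^-)^{(0)}_n(A)\cong\begin{cases}\mathbb{Q}& n\text{ even and }n\le 0,\\ 0&\text{else,}\end{cases}$$ and for every integer $w>0$ $$(HC^-)^{(w)}_n(A)\cong\begin{cases}\displaystyle\bigoplus_{m\mid w,\ m\equiv w\ (\mathrm{mod}\ 2)}\ \bigoplus_{\omega_{m,d}}\mathbb{Q}& n=w,\\ 0&\text{else,}\end{cases}$$ as $\mathbb{Q}$-vector spaces, for all $n\in\mathbb{Z}$. Moreover, for every $m\ge 1$, $\omega_{m,d}$ has $\frac1m\sum_{i\mid m}\mu(m/i)\,d^i$ elements, where $\mu$ is the Möbius function. -/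

import Mathlib

open scoped TensorProduct

noncomputable section

namespace NegCyc

/-! ### The Hochschild chain modules, faces, rotation and norm -/

section Cyclic

variable (k : Type*) [CommRing k] (A : Type*) [Ring A] [Algebra k A]

/-- `C_n(A) = A ⊗ ⋯ ⊗ A` (`n + 1` factors, over `k`). -/
abbrev Chain (n : ℕ) : Type _ := ⨂[k] (_ : Fin (n + 1)), A

/-- The operation on tuples behind the face `d_i` (`0 ≤ i ≤ n + 1`):
for `i ≤ n` it sends `(a_0, …, a_{n+1})` to `(a_0, …, a_i a_{i+1}, …, a_{n+1})`,
and for `i = n + 1` to `(a_{n+1} a_0, a_1, …, a_n)`. -/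
def faceFun {A : Type*} [Mul A] {n : ℕ} (i : ℕ) (a : Fin (n + 2) → A) (j : Fin (n + 1)) : A :=
  if i ≤ n then
    if (j : ℕ) < i then a j.castSucc
    else if (j : ℕ) = i then a j.castSucc * a j.succ
    else a j.succ
  else
    if j = 0 then a (Fin.last (n + 1)) * a 0 else a j.castSucc

variable {A} in
theorem faceFun_update {n : ℕ} (i : ℕ) (a : Fin (n + 2) → A) (l : Fin (n + 2)) :
    ∃ (j : Fin (n + 1)) (f : A →ₗ[k] A), ∀ x : A,
      faceFun i (Function.update a l x) = Function.update (faceFun i a) j (f x) := by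
  by_cases hi : i ≤ n
  · rcases lt_trichotomy (l : ℕ) i with h | h | h
    · refine ⟨⟨l, by omega⟩, LinearMap.id, fun x => ?_⟩
      ext j
      simp only [faceFun, Function.update_apply, Fin.ext_iff, hi, if_true, Fin.val_castSucc,
        Fin.val_succ, LinearMap.id_apply]
      grind
    · refine ⟨⟨l, by omega⟩, LinearMap.mulRight k (a ⟨i + 1, by omega⟩), fun x => ?_⟩
      ext j
      by_cases hj : (j : ℕ) = i
      · have e : j.succ = ⟨i + 1, by omega⟩ := Fin.ext (by simp [hj])
        simp [faceFun, Function.update_apply, Fin.ext_iff, hi, hj, h, e]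
      · simp only [faceFun, Function.update_apply, Fin.ext_iff, hi, if_true, Fin.val_castSucc,
          Fin.val_succ]
        grind
    · by_cases h' : (l : ℕ) = i + 1
      · refine ⟨⟨i, by omega⟩, LinearMap.mulLeft k (a ⟨i, by omega⟩), fun x => ?_⟩
        ext j
        by_cases hj : (j : ℕ) = i
        · have e : j.castSucc = ⟨i, by omega⟩ := Fin.ext (by simp [hj])
          simp [faceFun, Function.update_apply, Fin.ext_iff, hi, hj, h', e]
        · simp only [faceFun, Function.update_apply, Fin.ext_iff, hi, if_true, Fin.val_castSucc,
            Fin.val_succ]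
          grind
      · refine ⟨⟨l - 1, by omega⟩, LinearMap.id, fun x => ?_⟩
        ext j
        simp only [faceFun, Function.update_apply, Fin.ext_iff, hi, if_true, Fin.val_castSucc,
          Fin.val_succ, LinearMap.id_apply]
        grind
  · by_cases h0 : (l : ℕ) = 0
    · refine ⟨0, LinearMap.mulLeft k (a (Fin.last (n + 1))), fun x => ?_⟩
      ext j
      simp only [faceFun, Function.update_apply, Fin.ext_iff, hi, if_false, Fin.val_castSucc,
        Fin.val_last, Fin.val_zero, LinearMap.mulLeft_apply, h0]
      grind
    · by_cases h1 : (l : ℕ) = n + 1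
      · refine ⟨0, LinearMap.mulRight k (a 0), fun x => ?_⟩
        ext j
        simp only [faceFun, Function.update_apply, Fin.ext_iff, hi, if_false, Fin.val_castSucc,
          Fin.val_last, Fin.val_zero, LinearMap.mulRight_apply, h1]
        grind
      · refine ⟨⟨l, by omega⟩, LinearMap.id, fun x => ?_⟩
        ext j
        simp only [faceFun, Function.update_apply, Fin.ext_iff, hi, if_false, Fin.val_castSucc,
          Fin.val_last, Fin.val_zero, LinearMap.id_apply]
        grind

/-- The face map `d_i : A^{⊗ n+2} → A^{⊗ n+1}`, `0 ≤ i ≤ n + 1`. -/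
def face (n i : ℕ) : Chain k A (n + 1) →ₗ[k] Chain k A n :=
  PiTensorProduct.lift
    { toFun := fun a => PiTensorProduct.tprod k (faceFun i a)
      map_update_add' := by
        intro inst a l x y
        obtain ⟨j, f, hf⟩ := faceFun_update k i a l
        have e : inst = instDecidableEqFin _ := Subsingleton.elim _ _
        subst e
        simp only [hf, map_add, MultilinearMap.map_update_add]
      map_update_smul' := by
        intro inst a l c x
        obtain ⟨j, f, hf⟩ := faceFun_update k i a l
        have e : inst = instDecidableEqFin _ := Subsingleton.elim _ _
        subst e
        simp only [hf, map_smul, MultilinearMap.map_update_smul] }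

@[simp] theorem face_tprod (n i : ℕ) (a : Fin (n + 2) → A) :
    face k A n i (PiTensorProduct.tprod k a) = PiTensorProduct.tprod k (faceFun i a) := by
  simp [face]

/-- The Hochschild boundary `b : A^{⊗ n+2} → A^{⊗ n+1}`. -/
def bMap (n : ℕ) : Chain k A (n + 1) →ₗ[k] Chain k A n :=
  ∑ i ∈ Finset.range (n + 2), (-1 : k) ^ i • face k A n i

/-- The bar differential `b' : A^{⊗ n+2} → A^{⊗ n+1}`: the last face is omitted. -/
def bMap' (n : ℕ) : Chain k A (n + 1) →ₗ[k] Chain k A n :=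
  ∑ i ∈ Finset.range (n + 1), (-1 : k) ^ i • face k A n i

/-- The unsigned rotation `a_0 ⊗ ⋯ ⊗ a_n ↦ a_n ⊗ a_0 ⊗ ⋯ ⊗ a_{n-1}`. -/
def rot (n : ℕ) : Chain k A n →ₗ[k] Chain k A n :=
  (PiTensorProduct.reindex k (fun _ => A) (finRotate (n + 1))).toLinearMap

/-- The signed cyclic operator `t_n = (-1)^n rot`. -/
def tMap (n : ℕ) : Chain k A n →ₗ[k] Chain k A n := (-1 : k) ^ n • rot k A n

/-- The norm `N_n = 1 + t_n + ⋯ + t_n^n`. -/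
def normMap (n : ℕ) : Chain k A n →ₗ[k] Chain k A n :=
  ∑ i ∈ Finset.range (n + 1), tMap k A n ^ i


/-! ### The total differential squares to zero -/

@[simp] theorem rot_tprod (n : ℕ) (a : Fin (n + 1) → A) :
    rot k A n (PiTensorProduct.tprod k a) =
      PiTensorProduct.tprod k (fun i => a ((finRotate (n + 1)).symm i)) := by
  simp [rot]

theorem finRotate_symm_val {n : ℕ} (i : Fin (n + 1)) :
    (((finRotate (n + 1)).symm i : Fin (n + 1)) : ℕ) = if (i : ℕ) = 0 then n else (i : ℕ) - 1 := by
  rw [finRotate_symm_apply, Fin.coe_sub_one]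
  simp only [Fin.ext_iff, Fin.val_zero]

theorem rotIter_tprod (n j : ℕ) (a : Fin (n + 1) → A) :
    (rot k A n ^ j) (PiTensorProduct.tprod k a) =
      PiTensorProduct.tprod k (fun i => a ((((finRotate (n + 1)).symm : Equiv.Perm (Fin (n + 1))) ^ j) i)) := by
  induction j generalizing a with
  | zero => simp
  | succ j ih =>
    rw [pow_succ, Module.End.mul_apply, rot_tprod, ih]
    simp only [pow_succ', Equiv.Perm.mul_apply]

theorem rot_pow (n : ℕ) : rot k A n ^ (n + 1) = 1 := by
  apply PiTensorProduct.ext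
  ext a
  have h : ((finRotate (n + 1)).symm : Equiv.Perm (Fin (n + 1))) ^ (n + 1) = 1 := by
    change (finRotate (n + 1))⁻¹ ^ (n + 1) = 1
    rw [inv_pow, inv_eq_one]
    rcases n with _ | n
    · ext i; omega
    · have h1 : orderOf (finRotate (n + 2)) = n + 2 := by
        rw [isCycle_finRotate.orderOf, support_finRotate]; simp
      exact orderOf_dvd_iff_pow_eq_one.mp (by rw [h1])
  simp only [LinearMap.compMultilinearMap_apply, rotIter_tprod, Module.End.one_apply]
  congr 1
  funext i
  exact congrArg a (DFunLike.congr_fun h i)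

theorem tMap_pow (n : ℕ) : tMap k A n ^ (n + 1) = 1 := by
  rw [tMap, smul_pow, rot_pow, ← pow_mul, Even.neg_one_pow (Nat.even_mul_succ_self n), one_smul]

theorem face_comp_rot (n i : ℕ) (hi : i ≤ n) :
    face k A n (i + 1) ∘ₗ rot k A (n + 1) = rot k A n ∘ₗ face k A n i := by
  apply PiTensorProduct.ext
  ext a
  simp only [LinearMap.compMultilinearMap_apply, LinearMap.comp_apply, rot_tprod, face_tprod]
  congr 1
  funext j
  have key : ∀ x y : Fin (n + 2), (x : ℕ) = y → a x = a y := fun x y h => by rw [Fin.ext h]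
  have hj := j.2
  simp only [faceFun, hi, if_true, Fin.ext_iff, Fin.val_zero, finRotate_symm_val]
  split_ifs <;> first
    | omega
    | (refine congrArg₂ (· * ·) (key _ _ ?_) (key _ _ ?_) <;>
        simp only [Fin.val_succ, Fin.val_castSucc, Fin.val_last, Fin.val_zero,
          finRotate_symm_val] <;> grind)
    | (refine key _ _ ?_
       simp only [Fin.val_succ, Fin.val_castSucc, finRotate_symm_val]
       grind)

theorem face_zero_comp_rot (n : ℕ) :
    face k A n 0 ∘ₗ rot k A (n + 1) = face k A n (n + 1) := by
  apply PiTensorProduct.ext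
  ext a
  simp only [LinearMap.compMultilinearMap_apply, LinearMap.comp_apply, rot_tprod, face_tprod]
  congr 1
  funext j
  have key : ∀ x y : Fin (n + 2), (x : ℕ) = y → a x = a y := fun x y h => by rw [Fin.ext h]
  have hj := j.2
  simp only [faceFun, Fin.ext_iff, Fin.val_zero]
  split_ifs <;> first
    | omega
    | (refine congrArg₂ (· * ·) (key _ _ ?_) (key _ _ ?_) <;>
        simp only [Fin.val_succ, Fin.val_castSucc, Fin.val_last, Fin.val_zero,
          finRotate_symm_val] <;> grind)
    | (refine key _ _ ?_
       simp only [Fin.val_succ, Fin.val_castSucc, finRotate_symm_val]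
       grind)

theorem face_comp_face (n i j : ℕ) (hij : i ≤ j) (hj : j ≤ n + 1) :
    face k A n i ∘ₗ face k A (n + 1) (j + 1) = face k A n j ∘ₗ face k A (n + 1) i := by
  apply PiTensorProduct.ext
  ext a
  simp only [LinearMap.compMultilinearMap_apply, LinearMap.comp_apply, face_tprod]
  congr 1
  funext l
  have key : ∀ x y : Fin (n + 3), (x : ℕ) = y → a x = a y := fun x y h => by rw [Fin.ext h]
  have hl := l.2
  by_cases hjn : j ≤ n
  · have hin : i ≤ n := hij.trans hjn
    have hin' : i ≤ n + 1 := by omega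
    have hjn' : j + 1 ≤ n + 1 := by omega
    simp only [faceFun, Fin.val_succ, Fin.val_castSucc, hjn, hin, hin', hjn', if_true]
    rcases lt_trichotomy (l : ℕ) i with h | h | h
    · have h1 : (l : ℕ) < j := by omega
      have h2 : (l : ℕ) < j + 1 := by omega
      simp only [h, h1, h2, if_true]
    · rcases eq_or_lt_of_le hij with h' | h'
      · subst h'
        simp only [h, lt_irrefl, if_false, if_true, Nat.lt_succ_self]
        simp [mul_assoc]
      · simp [h, h', h'.trans (Nat.lt_succ_self j)]
    · have h1 : ¬ (l : ℕ) < i := by omega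
      have h2 : ¬ (l : ℕ) = i := by omega
      have h3 : ¬ (l : ℕ) + 1 < i := by omega
      have h4 : ¬ (l : ℕ) + 1 = i := by omega
      simp only [h1, h2, h3, h4, if_false, Nat.add_lt_add_iff_right, Nat.add_right_cancel_iff]
      rfl
  · obtain rfl : j = n + 1 := by omega
    by_cases hin : i ≤ n
    · have hin' : i ≤ n + 1 := by omega
      have h0 : ¬ n + 1 + 1 ≤ n + 1 := by omega
      have h1 : ¬ n + 1 < i := by omega
      have h2 : ¬ n + 1 = i := by omega
      by_cases hl0 : l = 0
      · subst hl0
        rcases Nat.eq_zero_or_pos i with rfl | hi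
        · simp [faceFun, mul_assoc]
        · simp [faceFun, hin, hin', h1, h2, hi]
      · have hl1 : ¬ (l : ℕ) = 0 := fun h => hl0 (Fin.ext h)
        simp only [faceFun, hin, hin', hjn, h0, if_true, if_false, Fin.ext_iff, Fin.val_zero,
          Fin.val_succ, Fin.val_castSucc, hl1, Nat.succ_ne_zero]
        rfl
    · obtain rfl : i = n + 1 := by omega
      have h0 : ¬ n + 1 + 1 ≤ n + 1 := by omega
      by_cases hl0 : l = 0
      · subst hl0
        simp [faceFun, mul_assoc]
      · have hl1 : ¬ (l : ℕ) = 0 := fun h => hl0 (Fin.ext h)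
        simp [faceFun, hl0, hl1, Fin.ext_iff]
        try omega

theorem comp_sum_lin {M N P : Type*} [AddCommMonoid M] [AddCommMonoid N] [AddCommMonoid P]
    [Module k M] [Module k N] [Module k P] (g : N →ₗ[k] P) (s : Finset ℕ) (f : ℕ → M →ₗ[k] N) :
    g ∘ₗ (∑ i ∈ s, f i) = ∑ i ∈ s, g ∘ₗ f i := by
  ext x; simp

theorem sum_comp_lin {M N P : Type*} [AddCommMonoid M] [AddCommMonoid N] [AddCommMonoid P]
    [Module k M] [Module k N] [Module k P] (g : M →ₗ[k] N) (s : Finset ℕ) (f : ℕ → N →ₗ[k] P) :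
    (∑ i ∈ s, f i) ∘ₗ g = ∑ i ∈ s, f i ∘ₗ g := by
  ext x; simp

theorem neg_smul_lin {m n : ℕ} (c : k) (f : Chain k A m →ₗ[k] Chain k A n) :
    (-c) • f = -(c • f) := by
  refine LinearMap.ext fun x => ?_
  exact neg_smul c (f x)

theorem altSum_comp_altSum (n m : ℕ) (hm : m ≤ n + 2) :
    (∑ i ∈ Finset.range m, (-1 : k) ^ i • face k A n i) ∘ₗ
      (∑ i ∈ Finset.range (m + 1), (-1 : k) ^ i • face k A (n + 1) i) = 0 := by
  induction m with
  | zero => simp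
  | succ m ih =>
    have h : (∑ i ∈ Finset.range (m + 1), (-1 : k) ^ i • face k A n i) ∘ₗ face k A (n + 1) (m + 1) =
        face k A n m ∘ₗ ∑ i ∈ Finset.range (m + 1), (-1 : k) ^ i • face k A (n + 1) i := by
      rw [sum_comp_lin, comp_sum_lin]
      refine Finset.sum_congr rfl fun i hi => ?_
      rw [LinearMap.smul_comp, LinearMap.comp_smul,
        face_comp_face k A n i m (by simpa [Nat.lt_succ_iff] using hi) (by omega)]
    rw [Finset.sum_range_succ _ (m + 1), LinearMap.comp_add, LinearMap.comp_smul, h,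
      Finset.sum_range_succ (fun i => (-1 : k) ^ i • face k A n i) m, LinearMap.add_comp,
      ih (by omega), LinearMap.smul_comp, zero_add, pow_succ, mul_neg_one, neg_smul_lin,
      add_neg_cancel]

theorem bMap_comp_bMap (n : ℕ) : bMap k A n ∘ₗ bMap k A (n + 1) = 0 :=
  altSum_comp_altSum k A n (n + 2) le_rfl

theorem bMap'_comp_bMap' (n : ℕ) : bMap' k A n ∘ₗ bMap' k A (n + 1) = 0 :=
  altSum_comp_altSum k A n (n + 1) (by omega)

theorem face_succ_comp_tMap (n i : ℕ) (hi : i ≤ n) :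
    face k A n (i + 1) ∘ₗ tMap k A (n + 1) = -(tMap k A n ∘ₗ face k A n i) := by
  rw [tMap, tMap, LinearMap.comp_smul, face_comp_rot k A n i hi, LinearMap.smul_comp, pow_succ,
    mul_neg_one, neg_smul_lin]

theorem face_zero_comp_tMap (n : ℕ) :
    face k A n 0 ∘ₗ tMap k A (n + 1) = (-1 : k) ^ (n + 1) • face k A n (n + 1) := by
  rw [tMap, LinearMap.comp_smul, face_zero_comp_rot]

theorem bMap_eq (n : ℕ) : bMap k A n = bMap' k A n + face k A n 0 ∘ₗ tMap k A (n + 1) := by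
  rw [face_zero_comp_tMap, bMap, bMap', Finset.sum_range_succ]

theorem bMap_comp_tMap (n : ℕ) :
    bMap k A n ∘ₗ tMap k A (n + 1) =
      face k A n 0 ∘ₗ tMap k A (n + 1) + tMap k A n ∘ₗ bMap' k A n := by
  rw [bMap, bMap', Finset.sum_range_succ', LinearMap.add_comp, sum_comp_lin,
    comp_sum_lin, pow_zero, one_smul]
  refine (add_comm _ _).trans ?_
  congr 1
  refine Finset.sum_congr rfl fun i hi => ?_
  rw [LinearMap.smul_comp, LinearMap.comp_smul,
    face_succ_comp_tMap k A n i (by simpa [Nat.lt_succ_iff] using hi), pow_succ, mul_neg_one,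
    neg_smul_lin, smul_neg, neg_neg]

theorem one_sub_tMap_comp_bMap' (n : ℕ) :
    (1 - tMap k A n) ∘ₗ bMap' k A n = bMap k A n ∘ₗ (1 - tMap k A (n + 1)) := by
  rw [LinearMap.sub_comp, LinearMap.comp_sub, bMap_comp_tMap]
  conv_rhs => rw [bMap_eq]
  simp only [Module.End.one_eq_id, LinearMap.id_comp, LinearMap.comp_id]
  abel

theorem face_comp_tMap_pow (n i : ℕ) (hi : i ≤ n + 1) :
    face k A n i ∘ₗ (tMap k A (n + 1) ^ i : Module.End k (Chain k A (n + 1))) =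
      (-1 : k) ^ i • (tMap k A n ^ i : Module.End k (Chain k A n)) ∘ₗ face k A n 0 := by
  induction i with
  | zero => simp [Module.End.one_eq_id]
  | succ i ih =>
    rw [pow_succ', Module.End.mul_eq_comp, ← LinearMap.comp_assoc,
      face_succ_comp_tMap k A n i (by omega), LinearMap.neg_comp, LinearMap.comp_assoc,
      ih (by omega), LinearMap.comp_smul, ← LinearMap.comp_assoc, ← Module.End.mul_eq_comp,
      ← pow_succ', pow_succ (-1 : k), mul_neg_one, neg_smul_lin]

theorem tMap_mul_normMap (n : ℕ) : tMap k A n * normMap k A n = normMap k A n := by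
  have h := mul_geom_sum (tMap k A n) (n + 1)
  rw [tMap_pow, sub_self, sub_mul, one_mul, sub_eq_zero] at h
  exact h

theorem normMap_mul_tMap (n : ℕ) : normMap k A n * tMap k A n = normMap k A n := by
  have h := geom_sum_mul (tMap k A n) (n + 1)
  rw [tMap_pow, sub_self, mul_sub, mul_one, sub_eq_zero] at h
  exact h

theorem tMap_pow_mul_normMap (n i : ℕ) : tMap k A n ^ i * normMap k A n = normMap k A n := by
  induction i with
  | zero => simp
  | succ i ih => rw [pow_succ, mul_assoc, tMap_mul_normMap, ih]

theorem normMap_mul_tMap_pow (n i : ℕ) : normMap k A n * tMap k A n ^ i = normMap k A n := by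
  induction i with
  | zero => simp
  | succ i ih => rw [pow_succ', ← mul_assoc, normMap_mul_tMap, ih]

theorem smul_face_comp_normMap (n i : ℕ) (hi : i ≤ n + 1) :
    ((-1 : k) ^ i • face k A n i) ∘ₗ normMap k A (n + 1) =
      (tMap k A n ^ i : Module.End k (Chain k A n)) ∘ₗ face k A n 0 ∘ₗ normMap k A (n + 1) := by
  conv_lhs => rw [← tMap_pow_mul_normMap k A (n + 1) i, Module.End.mul_eq_comp,
    ← LinearMap.comp_assoc, LinearMap.smul_comp, face_comp_tMap_pow k A n i hi, smul_smul,
    ← mul_pow, neg_one_mul, neg_neg, one_pow, one_smul]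
  rw [LinearMap.comp_assoc]

theorem tMap_pow_inv (n i : ℕ) (hi : i ≤ n + 1) :
    tMap k A n ^ i * tMap k A n ^ (n + 1 - i) = 1 := by
  rw [← pow_add, Nat.add_sub_cancel' hi, tMap_pow]

theorem normMap_comp_smul_face (n i : ℕ) (hi : i ≤ n + 1) :
    normMap k A n ∘ₗ ((-1 : k) ^ i • face k A n i) =
      normMap k A n ∘ₗ face k A n 0 ∘ₗ
        (tMap k A (n + 1) ^ (n + 2 - i) : Module.End k (Chain k A (n + 1))) := by
  have h : (-1 : k) ^ i • face k A n i =
      (tMap k A n ^ i : Module.End k (Chain k A n)) ∘ₗ face k A n 0 ∘ₗ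
        (tMap k A (n + 1) ^ (n + 2 - i) : Module.End k (Chain k A (n + 1))) := by
    have h1 : (tMap k A n ^ i : Module.End k (Chain k A n)) ∘ₗ face k A n 0 =
        (-1 : k) ^ i • face k A n i ∘ₗ
          (tMap k A (n + 1) ^ i : Module.End k (Chain k A (n + 1))) := by
      rw [face_comp_tMap_pow k A n i hi, smul_smul, ← mul_pow, neg_one_mul, neg_neg, one_pow,
        one_smul]
    rw [← LinearMap.comp_assoc, h1, LinearMap.smul_comp, LinearMap.comp_assoc,
      ← Module.End.mul_eq_comp, tMap_pow_inv k A (n + 1) i (by omega), Module.End.one_eq_id,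
      LinearMap.comp_id]
  rw [h, ← LinearMap.comp_assoc, ← Module.End.mul_eq_comp, normMap_mul_tMap_pow]

theorem normMap_comp_bMap (n : ℕ) :
    normMap k A n ∘ₗ bMap k A n = bMap' k A n ∘ₗ normMap k A (n + 1) := by
  have h1 : bMap' k A n ∘ₗ normMap k A (n + 1) =
      normMap k A n ∘ₗ face k A n 0 ∘ₗ normMap k A (n + 1) := by
    rw [bMap', sum_comp_lin]
    conv_rhs => rw [normMap, sum_comp_lin]
    exact Finset.sum_congr rfl fun i hi =>
      smul_face_comp_normMap k A n i (by have := Finset.mem_range.mp hi; omega)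
  rw [h1, bMap, comp_sum_lin]
  have h2 : normMap k A (n + 1) =
      ∑ i ∈ Finset.range (n + 2), tMap k A (n + 1) ^ (n + 2 - i) := by
    rw [← tMap_mul_normMap, normMap, Finset.mul_sum,
      ← Finset.sum_range_reflect _ (n + 1 + 1)]
    refine Finset.sum_congr rfl fun i hi => ?_
    have := Finset.mem_range.mp hi
    rw [← pow_succ']
    congr 1
    omega
  rw [h2, comp_sum_lin, comp_sum_lin]
  exact Finset.sum_congr rfl fun i hi =>
    normMap_comp_smul_face k A n i (by have := Finset.mem_range.mp hi; omega)

/-! ### The double complex and its total differential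

Column `p : ℤ`, row `q : ℕ`; the entry in every place is `Chain k A q`.  Even columns carry `b`,
odd columns carry `-b'` (the sign makes the squares anticommute); the horizontal map leaving an
even column is `N`, the one leaving an odd column is `1 - t`. -/

/-- The vertical map of column `p`, from row `q + 1` to row `q`. -/
def vert (p : ℤ) (q : ℕ) : Chain k A (q + 1) →ₗ[k] Chain k A q :=
  if Even p then bMap k A q else -bMap' k A q

/-- The horizontal map of row `q`, from column `p` to column `p - 1`. -/
def horiz (p : ℤ) (q : ℕ) : Chain k A q →ₗ[k] Chain k A q :=
  if Even p then normMap k A q else 1 - tMap k A q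

/-- The total differential in degree `n`.  A family `x` of total degree `n` has its component
`x q` in row `q` and column `n - q`; the component of `d x` in row `q` and column `n - 1 - q`
is the sum of a vertical and a horizontal contribution. -/
def totalD (n : ℤ) : (∀ q : ℕ, Chain k A q) →ₗ[k] (∀ q : ℕ, Chain k A q) :=
  LinearMap.pi fun q =>
    vert k A (n - 1 - q) q ∘ₗ LinearMap.proj (q + 1) + horiz k A (n - q) q ∘ₗ LinearMap.proj q

theorem vert_comp_vert (p : ℤ) (q : ℕ) : vert k A p q ∘ₗ vert k A p (q + 1) = 0 := by
  by_cases hp : Even p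
  · simp [vert, hp, bMap_comp_bMap]
  · simp [vert, hp, LinearMap.neg_comp, LinearMap.comp_neg, bMap'_comp_bMap']

theorem horiz_comp_horiz (p : ℤ) (q : ℕ) : horiz k A (p - 1) q ∘ₗ horiz k A p q = 0 := by
  by_cases hp : Even p
  · have hp' : ¬ Even (p - 1) := by rw [Int.even_sub_one]; simpa using hp
    rw [horiz, horiz, if_pos hp, if_neg hp', ← Module.End.mul_eq_comp, sub_mul, one_mul,
      tMap_mul_normMap, sub_self]
  · have hp' : Even (p - 1) := by rw [Int.even_sub_one]; simpa using hp
    rw [horiz, horiz, if_neg hp, if_pos hp', ← Module.End.mul_eq_comp, mul_sub, mul_one,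
      normMap_mul_tMap, sub_self]

theorem vert_comp_horiz (p : ℤ) (q : ℕ) :
    vert k A (p - 1) q ∘ₗ horiz k A p (q + 1) + horiz k A p q ∘ₗ vert k A p q = 0 := by
  by_cases hp : Even p
  · have hp' : ¬ Even (p - 1) := by rw [Int.even_sub_one]; simpa using hp
    rw [vert, vert, horiz, horiz, if_neg hp', if_pos hp, if_pos hp, if_pos hp,
      normMap_comp_bMap, LinearMap.neg_comp, neg_add_cancel]
  · have hp' : Even (p - 1) := by rw [Int.even_sub_one]; simpa using hp
    rw [vert, vert, horiz, horiz, if_pos hp', if_neg hp, if_neg hp, if_neg hp,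
      ← one_sub_tMap_comp_bMap', LinearMap.comp_neg, add_neg_cancel]

/-- The total differential squares to zero. -/
theorem totalD_comp_totalD (n : ℤ) : totalD k A n ∘ₗ totalD k A (n + 1) = 0 := by
  refine LinearMap.ext fun x => funext fun q => ?_
  have e1 : n + 1 - 1 - ((q + 1 : ℕ) : ℤ) = n - 1 - q := by push_cast; ring
  have e2 : n + 1 - ((q + 1 : ℕ) : ℤ) = n - q := by push_cast; ring
  have e3 : n + 1 - 1 - (q : ℤ) = n - q := by ring
  have e4 : n - 1 - (q : ℤ) = n - q - 1 := by ring
  have e5 : n - (q : ℤ) = n + 1 - q - 1 := by ring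
  have h1 := LinearMap.congr_fun (vert_comp_vert k A (n - q - 1) q) (x (q + 1 + 1))
  have h2 := LinearMap.congr_fun (vert_comp_horiz k A (n - q) q) (x (q + 1))
  have h3 := LinearMap.congr_fun (horiz_comp_horiz k A (n + 1 - q) q) (x q)
  rw [← e5] at h3
  simp only [LinearMap.comp_apply, LinearMap.add_apply, LinearMap.zero_apply] at h1 h2 h3
  simp only [totalD, LinearMap.comp_apply, LinearMap.pi_apply, LinearMap.add_apply,
    LinearMap.proj_apply, map_add, LinearMap.zero_apply, Pi.zero_apply, e1, e2, e3, e4, h1, h3]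
  rw [zero_add, add_zero, h2]

/-- The degree `n` part of the (product) total complex of the second quadrant double complex:
the product of all entries in the places `(p, q)` with `p + q = n`, `p ≤ 0`, `q ≥ 0`, written as
the families that vanish in the rows `q` with `n - q > 0`. -/
def negTot (n : ℤ) : Submodule k (∀ q : ℕ, Chain k A q) where
  carrier := {x | ∀ q : ℕ, 0 < n - q → x q = 0}
  add_mem' hx hy q hq := by simp [hx q hq, hy q hq]
  zero_mem' _ _ := rfl
  smul_mem' c x hx q hq := by simp [hx q hq]

theorem totalD_mem_negTot (n : ℤ) {x : ∀ q : ℕ, Chain k A q} (hx : x ∈ negTot k A (n + 1)) :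
    totalD k A (n + 1) x ∈ negTot k A n := by
  intro q hq
  have h1 : x (q + 1) = 0 := hx (q + 1) (by push_cast; omega)
  have h2 : x q = 0 := hx q (by omega)
  simp [totalD, h1, h2]

/-- Given a family `S` of submodules `S q ⊆ A^{⊗ q+1}` (stable under the maps of the
double complex), the part of `negTot`
with all components in `S`. -/
def negTotIn (S : ∀ q : ℕ, Submodule k (Chain k A q)) (n : ℤ) :
    Submodule k (∀ q : ℕ, Chain k A q) :=
  negTot k A n ⊓ Submodule.pi Set.univ S

/-- Cycles of degree `n` of the negative cyclic complex with components in `S`. -/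
def negCycles (S : ∀ q : ℕ, Submodule k (Chain k A q)) (n : ℤ) :
    Submodule k (∀ q : ℕ, Chain k A q) :=
  LinearMap.ker (totalD k A n) ⊓ negTotIn k A S n

/-- Boundaries of degree `n` of the negative cyclic complex with components in `S`. -/
def negBoundaries (S : ∀ q : ℕ, Submodule k (Chain k A q)) (n : ℤ) :
    Submodule k (∀ q : ℕ, Chain k A q) :=
  (negTotIn k A S (n + 1)).map (totalD k A (n + 1))

/-- The degree `n` homology (cycles modulo boundaries) of the part of the negative cyclic complex
of `A` with components in `S`. For `S = ⊤` this is the negative cyclic homology of `A`. -/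
abbrev HCNegIn (S : ∀ q : ℕ, Submodule k (Chain k A q)) (n : ℤ) : Type _ :=
  negCycles k A S n ⧸ (negBoundaries k A S n).submoduleOf (negCycles k A S n)

end Cyclic

/-! ### The algebra `k[x_1, …, x_d] / 𝔪²` and the weight decomposition -/

section Trunc

variable (k : Type*) [CommRing k] (d : ℕ)

/-- `A = k[x_1, …, x_d] / 𝔪²`, where `𝔪 = (x_1, …, x_d)`. -/
abbrev Trunc : Type _ :=
  MvPolynomial (Fin d) k ⧸ (Ideal.span (Set.range (MvPolynomial.X : Fin d → MvPolynomial (Fin d) k))) ^ 2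

/-- The elements of `A` of weight `e`: the classes of the homogeneous polynomials of degree `e`. -/
def homPart (e : ℕ) : Submodule k (Trunc k d) :=
  (MvPolynomial.homogeneousSubmodule (Fin d) k e).map
    (Ideal.Quotient.mkₐ k
      ((Ideal.span (Set.range (MvPolynomial.X : Fin d → MvPolynomial (Fin d) k))) ^ 2)).toLinearMap

/-- The weight `w` part of `A^{⊗ q+1}`: the span of the tensors of homogeneous elements whose
weights add up to `w`. -/
def weightPart (w q : ℕ) : Submodule k (Chain k (Trunc k d) q) :=
  Submodule.span k {x | ∃ (e : Fin (q + 1) → ℕ) (a : Fin (q + 1) → Trunc k d),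
    (∀ i, a i ∈ homPart k d (e i)) ∧ ∑ i, e i = w ∧ x = PiTensorProduct.tprod k a}

theorem mul_mem_homPart {e f : ℕ} {a b : Trunc k d} (ha : a ∈ homPart k d e)
    (hb : b ∈ homPart k d f) : a * b ∈ homPart k d (e + f) := by
  obtain ⟨p, hp, rfl⟩ := ha
  obtain ⟨r, hr, rfl⟩ := hb
  exact ⟨p * r, MvPolynomial.IsHomogeneous.mul hp hr, by simp⟩

theorem prod_faceFun {M : Type*} [CommMonoid M] {n : ℕ} (i : ℕ) (a : Fin (n + 2) → M) :
    ∏ j, faceFun i a j = ∏ j, a j := by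
  by_cases hi : i ≤ n
  · let a' : ℕ → M := fun x => if h : x < n + 2 then a ⟨x, h⟩ else 1
    have h1 : ∏ j, a j = ∏ x ∈ Finset.range (n + 2), a' x := by
      rw [← Fin.prod_univ_eq_prod_range]
      exact Finset.prod_congr rfl fun j _ => by simp [a']
    have h2 : ∏ j, faceFun i a j = ∏ x ∈ Finset.range (n + 1),
        (if x < i then a' x else if x = i then a' x * a' (x + 1) else a' (x + 1)) := by
      rw [← Fin.prod_univ_eq_prod_range]
      refine Finset.prod_congr rfl fun j _ => ?_
      have hj : (j : ℕ) < n + 2 := by omega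
      have hj' : (j : ℕ) + 1 < n + 2 := by omega
      simp only [faceFun, hi, if_true, a', hj, hj', dif_pos]
      rfl
    have h3 : ∀ m, ∏ x ∈ Finset.range m,
        (if x < i then a' x else if x = i then a' x * a' (x + 1) else a' (x + 1)) =
        if m ≤ i then ∏ x ∈ Finset.range m, a' x else ∏ x ∈ Finset.range (m + 1), a' x := by
      intro m
      induction m with
      | zero => simp
      | succ m ih =>
        rw [Finset.prod_range_succ, ih]
        rcases lt_trichotomy m i with h | h | h
        · rw [if_pos h.le, if_pos h, if_pos (by omega), Finset.prod_range_succ]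
        · rw [if_pos h.le, if_neg (by omega), if_pos h, if_neg (by omega),
            Finset.prod_range_succ, Finset.prod_range_succ, mul_assoc]
        · rw [if_neg (by omega), if_neg (by omega), if_neg (by omega), if_neg (by omega),
            Finset.prod_range_succ _ (m + 1)]
    rw [h1, h2, h3, if_neg (by omega)]
  · rw [Fin.prod_univ_succ, Fin.prod_univ_castSucc a, Fin.prod_univ_succ (fun j => a j.castSucc)]
    simp only [faceFun, hi, if_false, if_true, Fin.succ_ne_zero, Fin.castSucc_zero]
    rw [mul_comm _ (a (Fin.last (n + 1))), mul_assoc]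

theorem faceFun_mem_homPart {q : ℕ} (i : ℕ) {e : Fin (q + 2) → ℕ} {a : Fin (q + 2) → Trunc k d}
    (ha : ∀ l, a l ∈ homPart k d (e l)) (j : Fin (q + 1)) :
    faceFun i a j ∈
      homPart k d (faceFun i (fun l => Multiplicative.ofAdd (e l)) j).toAdd := by
  unfold faceFun
  by_cases h1 : i ≤ q
  · rw [if_pos h1, if_pos h1]
    by_cases h2 : (j : ℕ) < i
    · rw [if_pos h2, if_pos h2]; exact ha _
    · rw [if_neg h2, if_neg h2]
      by_cases h3 : (j : ℕ) = i
      · rw [if_pos h3, if_pos h3]; exact mul_mem_homPart k d (ha _) (ha _)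
      · rw [if_neg h3, if_neg h3]; exact ha _
  · rw [if_neg h1, if_neg h1]
    by_cases h2 : j = 0
    · rw [if_pos h2, if_pos h2]; exact mul_mem_homPart k d (ha _) (ha _)
    · rw [if_neg h2, if_neg h2]; exact ha _

theorem face_mem_weightPart (w q i : ℕ) {x : Chain k (Trunc k d) (q + 1)}
    (hx : x ∈ weightPart k d w (q + 1)) : face k (Trunc k d) q i x ∈ weightPart k d w q := by
  suffices h : weightPart k d w (q + 1) ≤
      (weightPart k d w q).comap (face k (Trunc k d) q i) from h hx
  refine Submodule.span_le.mpr ?_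
  rintro _ ⟨e, a, ha, he, rfl⟩
  have hsum : ∑ j, (faceFun i (fun l => Multiplicative.ofAdd (e l)) j).toAdd = w := by
    rw [← toAdd_prod, prod_faceFun, toAdd_prod]
    exact he
  exact Submodule.subset_span ⟨_, faceFun i a, faceFun_mem_homPart k d i ha, hsum,
    face_tprod k _ q i a⟩

theorem tMap_mem_weightPart (w q : ℕ) {x : Chain k (Trunc k d) q}
    (hx : x ∈ weightPart k d w q) : tMap k (Trunc k d) q x ∈ weightPart k d w q := by
  suffices h : weightPart k d w q ≤ (weightPart k d w q).comap (rot k (Trunc k d) q) from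
    Submodule.smul_mem _ _ (h hx)
  refine Submodule.span_le.mpr ?_
  rintro _ ⟨e, a, ha, he, rfl⟩
  exact Submodule.subset_span ⟨fun j => e ((finRotate (q + 1)).symm j), _, fun j => ha _,
    by rw [Equiv.sum_comp]; exact he, rot_tprod k _ q a⟩

theorem altSum_mem_weightPart (w q m : ℕ) {x : Chain k (Trunc k d) (q + 1)}
    (hx : x ∈ weightPart k d w (q + 1)) :
    (∑ i ∈ Finset.range m, (-1 : k) ^ i • face k (Trunc k d) q i) x ∈ weightPart k d w q := by
  rw [LinearMap.sum_apply]
  exact Submodule.sum_mem _ fun i _ =>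
    Submodule.smul_mem _ _ (face_mem_weightPart k d w q i hx)

theorem vert_mem_weightPart (w : ℕ) (p : ℤ) (q : ℕ) {x : Chain k (Trunc k d) (q + 1)}
    (hx : x ∈ weightPart k d w (q + 1)) :
    vert k (Trunc k d) p q x ∈ weightPart k d w q := by
  rw [vert]
  split_ifs
  · exact altSum_mem_weightPart k d w q _ hx
  · exact Submodule.neg_mem _ (altSum_mem_weightPart k d w q _ hx)

theorem horiz_mem_weightPart (w : ℕ) (p : ℤ) (q : ℕ) {x : Chain k (Trunc k d) q}
    (hx : x ∈ weightPart k d w q) :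
    horiz k (Trunc k d) p q x ∈ weightPart k d w q := by
  rw [horiz]
  split_ifs
  · rw [normMap, LinearMap.sum_apply]
    have h : ∀ i : ℕ, (tMap k (Trunc k d) q ^ i) x ∈ weightPart k d w q := by
      intro i
      induction i with
      | zero => exact hx
      | succ i ih =>
        rw [pow_succ' (tMap k (Trunc k d) q) i, Module.End.mul_apply]
        exact tMap_mem_weightPart k d w q ih
    exact Submodule.sum_mem _ fun i _ => h i
  · exact Submodule.sub_mem _ hx (tMap_mem_weightPart k d w q hx)

/-- The weight `w` parts form a subcomplex of the negative cyclic complex. -/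
theorem totalD_mem_negTotIn (w : ℕ) (n : ℤ) {x : ∀ q : ℕ, Chain k (Trunc k d) q}
    (hx : x ∈ negTotIn k (Trunc k d) (weightPart k d w) (n + 1)) :
    totalD k (Trunc k d) (n + 1) x ∈ negTotIn k (Trunc k d) (weightPart k d w) n :=
  ⟨totalD_mem_negTot k _ n hx.1, fun q _ => Submodule.add_mem _
    (vert_mem_weightPart k d w _ q (hx.2 (q + 1) trivial))
    (horiz_mem_weightPart k d w _ q (hx.2 q trivial))⟩

/-- Boundaries are cycles, in every weight. -/
theorem negBoundaries_le_negCycles (w : ℕ) (n : ℤ) :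
    negBoundaries k (Trunc k d) (weightPart k d w) n ≤
      negCycles k (Trunc k d) (weightPart k d w) n := by
  rintro _ ⟨x, hx, rfl⟩
  exact ⟨LinearMap.congr_fun (totalD_comp_totalD k (Trunc k d) n) x,
    totalD_mem_negTotIn k d w n hx⟩

/-- `(HC⁻)_n^{(w)}(A)`, the weight `w` part of the negative cyclic homology of
`A = k[x_1, …, x_d] / 𝔪²`: the homology of the weight `w` part of the negative cyclic complex. -/
abbrev HCNegWeight (w : ℕ) (n : ℤ) : Type _ := HCNegIn k (Trunc k d) (weightPart k d w) n

end Trunc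

/-! ### Cyclic words -/

/-- Rotation of a word: `x_{j_1} ⋯ x_{j_m} ↦ x_{j_m} x_{j_1} ⋯ x_{j_{m-1}}`. -/
def rotWord {m d : ℕ} (v : Fin m → Fin d) : Fin m → Fin d := v ∘ (finRotate m).symm

/-- The cycle family of a word: all its rotations. -/
def cycleFamily {m d : ℕ} (v : Fin m → Fin d) : Set (Fin m → Fin d) :=
  {u | ∃ n : ℕ, u = rotWord^[n] v}

/-- The cycle length of a word: the smallest `l > 0` such that rotating `l` times fixes the word. -/
def cycleLength {m d : ℕ} (v : Fin m → Fin d) : ℕ := Function.minimalPeriod rotWord v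

/-- `ω_{m,d}`: the set of cycle families of the words of length `m` and cycle length `m` in
`d` letters. -/
def omega (m d : ℕ) : Set (Set (Fin m → Fin d)) :=
  {F | ∃ v : Fin m → Fin d, cycleLength v = m ∧ F = cycleFamily v}

end NegCyc

end

/-! Words in the letters 1, x_1, …, x_d form a basis of every tensor power, and on this basis each
column of the weight w double complex is contracted as far as possible. Odd columns carry the bar
differential and are contracted by x ↦ 1 ⊗ x (`bMap'_consMap_one`). Even columns carry the
Hochschild boundary; because x_i x_j = 0, an explicit homotopy on words (`hoch_htpy`,
`bMap_htpy_succ`) retracts them onto the words with no unit after the first letter. For w > 0 this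
leaves two rows: the words v of w generators in row w - 1, and the words 1 ⊗ v in row w, with
boundary 1 ⊗ v ↦ v - tv (`bMap_consMap_of_mem`). In weight zero only the unit in row 0 is left.

No reduced complex is constructed. Instead `exists_extension` solves D y = x upwards, row by row:
the equation in row q determines y_{q+1} from y_q, and the only obstruction is the residue `colRes`
of the column homotopy. The solution may have infinitely many components, which the product total
complex permits. All real work thus takes place in the surviving rows.

In weight zero the unit in row 0 gives one class for each even column p ≤ 0. In weight w > 0, the
surviving rows string together the maps 1 - t and N on the span of the words of w generators. Over a
field of characteristic zero that sequence is exact (`exists_sub_tMap_eq`, `exists_normMap_eq`), so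
homology remains only at the edge column 0, where the kernel of 1 - t sits in degree w
(`nonempty_HCNegWeight_equiv_cyclicInvariants`).

An element of this kernel is a function on words which rotation multiplies by (-1)^(w-1). On an
orbit with m elements it is zero unless (-1)^((w-1)m) = 1, that is m ≡ w mod 2, and otherwise it is
given by one free value (`bijective_evalAt`). Orbits with m elements correspond to ω_{m,d} by
repeating a word w/m times. The same correspondence gives ∑_{i ∣ w} i |ω_{i,d}| = d^w, and Möbius
inversion yields the count. -/

noncomputable section

namespace NegCyc

/-! ### A contracting homotopy on words

Words in the alphabet `Option ι`; the letter `none` stands for the unit, the letters `some i` for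
generators whose pairwise products vanish. -/

section Words

variable (k : Type*) [CommRing k] {ι : Type*}

/-- Formal linear combinations of words. -/
abbrev WordSpace (k : Type*) [CommRing k] (ι : Type*) : Type _ := List (Option ι) →₀ k

/-- The basis vector of a word. -/
abbrev word (l : List (Option ι)) : WordSpace k ι := Finsupp.single l 1

/-- Linear extension of a function on words. -/
abbrev wordLift (f : List (Option ι) → WordSpace k ι) : WordSpace k ι →ₗ[k] WordSpace k ι :=
  Finsupp.linearCombination k f

variable {k} in
theorem wordLift_word (f : List (Option ι) → WordSpace k ι) (l : List (Option ι)) :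
    wordLift k f (word k l) = f l := by simp

theorem wordSpace_hom_ext {M : Type*} [AddCommGroup M] [Module k M] {f g : WordSpace k ι →ₗ[k] M}
    (h : ∀ l, f (word k l) = g (word k l)) : f = g :=
  Finsupp.lhom_ext' fun l => LinearMap.ext_ring (h l)

/-- Put a letter in front. -/
def consL (a : Option ι) : WordSpace k ι →ₗ[k] WordSpace k ι := wordLift k fun l => word k (a :: l)

/-- Append a letter. -/
def snocL (a : Option ι) : WordSpace k ι →ₗ[k] WordSpace k ι :=
  wordLift k fun l => word k (l ++ [a])

@[simp] theorem consL_word (a : Option ι) (l : List (Option ι)) :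
    consL k a (word k l) = word k (a :: l) := by simp [consL]

@[simp] theorem snocL_word (a : Option ι) (l : List (Option ι)) :
    snocL k a (word k l) = word k (l ++ [a]) := by simp [snocL]

/-- The word `(ab) l`, or zero if the product of the letters vanishes. -/
def mulHead : Option ι → Option ι → List (Option ι) → WordSpace k ι
  | none, b, l => word k (b :: l)
  | some x, none, l => word k (some x :: l)
  | some _, some _, _ => 0

/-- Multiply the first two letters. -/
def headFun : List (Option ι) → WordSpace k ι
  | a :: b :: l => mulHead k a b l
  | _ => 0

/-- The bar differential of a word. -/
def barFun : List (Option ι) → WordSpace k ι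
  | a :: b :: l => mulHead k a b l - consL k a (barFun (b :: l))
  | _ => 0

/-- Move the last letter to the front. -/
def rotFun : List (Option ι) → WordSpace k ι
  | [] => 0
  | a :: l => word k ((a :: l).getLast (by simp) :: (a :: l).dropLast)

/-- The product of the last and the first letter, in front of the remaining letters. -/
def wrap : WordSpace k ι →ₗ[k] WordSpace k ι := wordLift k (headFun k) ∘ₗ wordLift k (rotFun k)

/-- The Hochschild boundary of a word. -/
def hochFun (l : List (Option ι)) : WordSpace k ι :=
  barFun k l + (-1 : k) ^ (l.length + 1) • wrap k (word k l)

/-- The number of leading unit letters. -/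
def lead : List (Option ι) → ℕ
  | none :: l => lead l + 1
  | _ => 0

/-- The number of leading unit letters before the last letter. -/
def leadInner : List (Option ι) → ℕ
  | none :: y :: l => leadInner (y :: l) + 1
  | _ => 0

/-- The homotopy: the first run of unit letters after the first letter is made longer if its
length is odd. -/
def htpyFun : List (Option ι) → WordSpace k ι
  | a :: none :: l => if Even (lead l) then word k (a :: none :: none :: l) else 0
  | a :: some x :: l => -consL k a (htpyFun (some x :: l))
  | _ => 0

/-- The homotopy which ignores the first and the last letter. -/
def htpyInner : List (Option ι) → WordSpace k ι
  | a :: none :: y :: l =>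
      if Even (leadInner (y :: l)) then word k (a :: none :: none :: y :: l) else 0
  | a :: some x :: y :: l => -consL k a (htpyInner (some x :: y :: l))
  | _ => 0

/-- The projection to the words without unit letters after the first letter. -/
def nondegFun : List (Option ι) → WordSpace k ι
  | _ :: none :: _ => 0
  | a :: some x :: l => consL k a (nondegFun (some x :: l))
  | l => word k l

/-- The projection to the words without unit letters other than the first and the last letter. -/
def nondegInner : List (Option ι) → WordSpace k ι
  | _ :: none :: _ :: _ => 0
  | a :: some x :: y :: l => consL k a (nondegInner (some x :: y :: l))
  | l => word k l

/-! ### Linearity of the homotopies in the outer letters -/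

theorem leadInner_append (l : List (Option ι)) (z : Option ι) :
    leadInner (l ++ [z]) = lead l := by
  induction l with
  | nil => cases z <;> rfl
  | cons a l ih =>
    cases a with
    | none => cases l <;> simp_all [lead, leadInner]
    | some x => rfl

theorem consL_snocL (a z : Option ι) (y : WordSpace k ι) :
    consL k a (snocL k z y) = snocL k z (consL k a y) := by
  have h : consL k a ∘ₗ snocL k z = snocL k z ∘ₗ consL k a := wordSpace_hom_ext k fun l => by simp
  exact LinearMap.congr_fun h y

/-- The last letter is carried along as a right coefficient. This makes it possible to transport the
homotopy formula from the bar differential to the Hochschild boundary. -/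
theorem htpyInner_append (l : List (Option ι)) (z : Option ι) :
    htpyInner k (l ++ [z]) = snocL k z (htpyFun k l) := by
  induction l with
  | nil => simp [htpyInner, htpyFun]
  | cons a l ih =>
    match l, ih with
    | [], _ => rcases z with _ | z <;> simp [htpyInner, htpyFun]
    | none :: l, _ =>
      have h := leadInner_append l z
      cases hl : l ++ [z] with
      | nil => simp at hl
      | cons y m =>
        rw [hl] at h
        simp only [List.cons_append, hl, htpyInner, htpyFun, h]
        split_ifs <;> simp [hl]
    | some x :: l, ih =>
      cases hl : l ++ [z] with
      | nil => simp at hl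
      | cons y m =>
        simp only [List.cons_append, hl, htpyInner, htpyFun] at ih ⊢
        rw [ih, consL_snocL, map_neg]

theorem nondegInner_append (l : List (Option ι)) (hl : l ≠ []) (z : Option ι) :
    nondegInner k (l ++ [z]) = snocL k z (nondegFun k l) := by
  induction l with
  | nil => simp at hl
  | cons a l ih =>
    match l, ih with
    | [], _ => rcases z with _ | z <;> simp [nondegInner, nondegFun]
    | none :: l, _ =>
      cases hl : l ++ [z] with
      | nil => simp at hl
      | cons y m => simp [List.cons_append, hl, nondegInner, nondegFun]
    | some x :: l, ih =>
      cases hl : l ++ [z] with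
      | nil => simp at hl
      | cons y m =>
        simp only [List.cons_append, hl, nondegInner, nondegFun] at ih ⊢
        rw [ih (by simp), consL_snocL]

/-- The first letter is never inspected: `g` does not depend on `a`. This is the left linearity
required by `wordLift_mulHead`. -/
theorem htpyFun_cons_eq (l : List (Option ι)) :
    ∃ g, ∀ a : Option ι, htpyFun k (a :: l) = consL k a g := by
  match l with
  | [] => exact ⟨0, fun a => by simp [htpyFun]⟩
  | none :: l =>
    refine ⟨if Even (lead l) then word k (none :: none :: l) else 0, fun a => ?_⟩
    simp only [htpyFun]; split_ifs <;> simp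
  | some x :: l => exact ⟨-htpyFun k (some x :: l), fun a => by simp [htpyFun]⟩

theorem htpyInner_cons_eq (l : List (Option ι)) :
    ∃ g, ∀ a : Option ι, htpyInner k (a :: l) = consL k a g := by
  match l with
  | [] => exact ⟨0, fun a => by simp [htpyInner]⟩
  | [none] => exact ⟨0, fun a => by simp [htpyInner]⟩
  | [some x] => exact ⟨0, fun a => by simp [htpyInner]⟩
  | none :: y :: l =>
    refine ⟨if Even (leadInner (y :: l)) then word k (none :: none :: y :: l) else 0, fun a => ?_⟩
    simp only [htpyInner]; split_ifs <;> simp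
  | some x :: y :: l => exact ⟨-htpyInner k (some x :: y :: l), fun a => by simp [htpyInner]⟩

theorem head_consL_none (b : Option ι) (g : WordSpace k ι) :
    wordLift k (headFun k) (consL k none (consL k b g)) = consL k b g := by
  have h : wordLift k (headFun k) ∘ₗ consL k none ∘ₗ consL k b = consL k b :=
    wordSpace_hom_ext k fun l => by simp [headFun, mulHead]
  exact LinearMap.congr_fun h g

theorem head_consL_some_none (x : ι) (g : WordSpace k ι) :
    wordLift k (headFun k) (consL k (some x) (consL k none g)) = consL k (some x) g := by
  have h : wordLift k (headFun k) ∘ₗ consL k (some x) ∘ₗ consL k none = consL k (some x) :=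
    wordSpace_hom_ext k fun l => by simp [headFun, mulHead]
  exact LinearMap.congr_fun h g

theorem head_consL_some_some (x y : ι) (g : WordSpace k ι) :
    wordLift k (headFun k) (consL k (some x) (consL k (some y) g)) = 0 := by
  have h : wordLift k (headFun k) ∘ₗ consL k (some x) ∘ₗ consL k (some y) = 0 :=
    wordSpace_hom_ext k fun l => by simp [headFun, mulHead]
  exact LinearMap.congr_fun h g

/-- A map which treats the first letter as a left coefficient commutes with the multiplication of
the first letter by another one. -/
theorem wordLift_mulHead (f : List (Option ι) → WordSpace k ι)
    (hf : ∀ l, ∃ g, ∀ a : Option ι, f (a :: l) = consL k a g) (z a : Option ι)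
    (l : List (Option ι)) :
    wordLift k f (mulHead k z a l) = wordLift k (headFun k) (consL k z (f (a :: l))) := by
  obtain ⟨g, hg⟩ := hf l
  rcases z with _ | z
  · rw [mulHead, wordLift_word, hg, head_consL_none]
  · rcases a with _ | a
    · rw [mulHead, wordLift_word, hg, hg, head_consL_some_none]
    · rw [mulHead, hg, head_consL_some_some, map_zero]

theorem bar_consL_consL (a b : Option ι) (g : WordSpace k ι) :
    wordLift k (barFun k) (consL k a (consL k b g)) =
      wordLift k (headFun k) (consL k a (consL k b g)) -
        consL k a (wordLift k (barFun k) (consL k b g)) := by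
  have h : wordLift k (barFun k) ∘ₗ consL k a ∘ₗ consL k b =
      wordLift k (headFun k) ∘ₗ consL k a ∘ₗ consL k b -
        consL k a ∘ₗ wordLift k (barFun k) ∘ₗ consL k b :=
    wordSpace_hom_ext k fun l => by simp [headFun, barFun]
  exact LinearMap.congr_fun h g

theorem htpyInner_consL_some (a : Option ι) (x : ι) (g : WordSpace k ι) :
    wordLift k (htpyInner k) (consL k a (consL k (some x) g)) =
      -consL k a (wordLift k (htpyInner k) (consL k (some x) g)) := by
  have h : wordLift k (htpyInner k) ∘ₗ consL k a ∘ₗ consL k (some x) =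
      -(consL k a ∘ₗ wordLift k (htpyInner k) ∘ₗ consL k (some x)) :=
    wordSpace_hom_ext k fun l => by cases l <;> simp [htpyInner]
  exact LinearMap.congr_fun h g

/-! ### The bar differential and the parity of runs of units -/

theorem barFun_some_cons (x : ι) (l : List (Option ι)) :
    ∃ g, barFun k (some x :: l) = consL k (some x) g := by
  match l with
  | [] => exact ⟨0, by simp [barFun]⟩
  | none :: l => exact ⟨word k l - barFun k (none :: l), by simp [barFun, mulHead]⟩
  | some y :: l => exact ⟨-barFun k (some y :: l), by simp [barFun, mulHead]⟩

theorem barFun_none_cons (y : Option ι) (l : List (Option ι)) :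
    barFun k (none :: y :: l) = word k (y :: l) - consL k none (barFun k (y :: l)) := by
  simp [barFun, mulHead]

/-- Words whose number of inner leading unit letters is even. -/
def evenLead : Submodule k (WordSpace k ι) :=
  Finsupp.supported k k {l | l ≠ [] ∧ Even (leadInner l)}

theorem consL_some_mem_evenLead (x : ι) (g : WordSpace k ι) :
    consL k (some x) g ∈ evenLead k := by
  suffices h : (⊤ : Submodule k (WordSpace k ι)) ≤ (evenLead k).comap (consL k (some x)) from
    h trivial
  rw [← Finsupp.supported_univ, Finsupp.supported_eq_span_single, Submodule.span_le]
  rintro _ ⟨l, -, rfl⟩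
  simp only [Submodule.comap_coe, Set.mem_preimage, consL_word]
  exact Finsupp.single_mem_supported k _ ⟨by simp, by simp [leadInner]⟩

theorem consL_none_none_mem_evenLead {g : WordSpace k ι} (hg : g ∈ evenLead k) :
    consL k none (consL k none g) ∈ evenLead k := by
  suffices h : evenLead k ≤ (evenLead k).comap (consL k none ∘ₗ consL k none) from h hg
  conv_lhs => rw [evenLead, Finsupp.supported_eq_span_single]
  rw [Submodule.span_le]
  rintro _ ⟨l, ⟨h0, h1⟩, rfl⟩
  simp only [Submodule.comap_coe, Set.mem_preimage, LinearMap.comp_apply, consL_word]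
  refine Finsupp.single_mem_supported k _ ⟨by simp, ?_⟩
  cases l with
  | nil => exact absurd rfl h0
  | cons y l => simpa [leadInner, Nat.even_add_one] using h1

/-- A leading generator x survives b', since x·1 = x and x·y = 0. Two leading units pass through b'
untouched, since the two faces absorbing a unit cancel. So the parity test in the homotopy gives the
same answer on every term of b'. -/
theorem barFun_mem_evenLead : ∀ l : List (Option ι), Even (leadInner l) → barFun k l ∈ evenLead k
  | [], _ => by simp [barFun]
  | [_], _ => by simp [barFun]
  | some x :: y :: l, _ => by
    obtain ⟨g, hg⟩ := barFun_some_cons k x (y :: l)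
    rw [hg]
    exact consL_some_mem_evenLead k x g
  | [none, y], h => by cases y <;> simp [leadInner] at h
  | none :: some x :: y :: l, h => by simp [leadInner] at h
  | none :: none :: y :: l, h => by
    have h' : Even (leadInner (y :: l)) := by
      simpa [leadInner, Nat.even_add_one] using h
    rw [barFun_none_cons, barFun_none_cons, map_sub, consL_word, sub_sub_cancel]
    exact consL_none_none_mem_evenLead k (barFun_mem_evenLead (y :: l) h')

theorem htpyInner_of_evenLead (a : Option ι) {g : WordSpace k ι} (hg : g ∈ evenLead k) :
    wordLift k (htpyInner k) (consL k a (consL k none g)) =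
      consL k a (consL k none (consL k none g)) := by
  suffices h : evenLead k ≤ LinearMap.eqLocus
      (wordLift k (htpyInner k) ∘ₗ consL k a ∘ₗ consL k none)
      (consL k a ∘ₗ consL k none ∘ₗ consL k none) from h hg
  rw [evenLead, Finsupp.supported_eq_span_single, Submodule.span_le]
  rintro _ ⟨l, ⟨h0, h1⟩, rfl⟩
  cases l with
  | nil => exact absurd rfl h0
  | cons y l =>
    simp only [SetLike.mem_coe, LinearMap.mem_eqLocus, LinearMap.comp_apply, consL_word,
      wordLift_word, htpyInner]
    rw [if_pos h1]

theorem htpyInner_none_of_evenLead (a : Option ι) {g : WordSpace k ι} (hg : g ∈ evenLead k) :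
    wordLift k (htpyInner k) (consL k a (consL k none (consL k none g))) = 0 := by
  suffices h : evenLead k ≤ LinearMap.ker
      (wordLift k (htpyInner k) ∘ₗ consL k a ∘ₗ consL k none ∘ₗ consL k none) from h hg
  rw [evenLead, Finsupp.supported_eq_span_single, Submodule.span_le]
  rintro _ ⟨l, ⟨h0, h1⟩, rfl⟩
  cases l with
  | nil => exact absurd rfl h0
  | cons y l =>
    simp only [SetLike.mem_coe, LinearMap.mem_ker, LinearMap.comp_apply, consL_word,
      wordLift_word, htpyInner, leadInner]
    exact if_neg (by simpa [Nat.even_add_one] using h1)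

/-- If the second letter is a unit, the parity of its run decides: for an odd run b'h returns the
word and its other terms cancel against hb'; for an even run h kills the word and hb' returns it. If
the second letter is a generator, h anticommutes with putting the first letter in front, and
induction on the tail applies. -/
theorem bar_htpyInner (l : List (Option ι)) : ∀ a y : Option ι,
    wordLift k (barFun k) (htpyInner k (a :: y :: l)) +
      wordLift k (htpyInner k) (barFun k (a :: y :: l)) =
        word k (a :: y :: l) - nondegInner k (a :: y :: l) := by
  induction l with
  | nil =>
    intro a y
    rcases a with _ | a <;> rcases y with _ | y <;>
      simp [htpyInner, barFun, nondegInner, mulHead]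
  | cons c l ih =>
    intro a y
    rcases y with _ | x
    -- The two faces absorbing the unit cancel, so b' acts only to the right of it.
    · have e1 : barFun k (a :: none :: c :: l) =
          consL k a (consL k none (barFun k (c :: l))) := by
        rw [barFun, barFun_none_cons, map_sub, consL_word]
        rcases a with _ | a <;> simp [mulHead]
      rw [e1]
      simp only [htpyInner, nondegInner, sub_zero]
      by_cases h : Even (leadInner (c :: l))
      · rw [if_pos h, htpyInner_of_evenLead k a (barFun_mem_evenLead k _ h), wordLift_word,
          barFun, barFun_none_cons, barFun_none_cons]
        rcases a with _ | a <;> simp [mulHead]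
      · rw [if_neg h]
        rcases c with _ | x
        · cases l with
          | nil => simp [leadInner] at h
          | cons y l =>
            have h' : Even (leadInner (y :: l)) := by
              simpa [leadInner, Nat.even_add_one] using h
            rw [barFun_none_cons, map_sub, map_sub, map_sub,
              htpyInner_none_of_evenLead k a (barFun_mem_evenLead k _ h')]
            simp [htpyInner, h']
        · simp [leadInner] at h
    · obtain ⟨g, hg⟩ := htpyInner_cons_eq k (c :: l)
      obtain ⟨g', hg'⟩ := barFun_some_cons k x (c :: l)
      have h1 := wordLift_mulHead k (htpyInner k) (htpyInner_cons_eq k) a (some x) (c :: l)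
      have h2 := ih (some x) c
      rw [htpyInner, barFun, map_sub, h1, map_neg, nondegInner]
      rw [hg', htpyInner_consL_some, ← hg', hg, bar_consL_consL, ← hg, ← consL_word, ← map_sub,
        ← h2, map_add]
      abel

/-! ### From the bar differential to the Hochschild boundary -/

theorem rotFun_append (l : List (Option ι)) (z : Option ι) :
    rotFun k (l ++ [z]) = word k (z :: l) := by
  cases l with
  | nil => rfl
  | cons a l =>
    simp only [List.cons_append, rotFun]
    congr 2
    · rw [List.getLast_cons (by simp), List.getLast_append_singleton]
    · rw [← List.cons_append, List.dropLast_concat]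

theorem wrap_word_append (l : List (Option ι)) (z : Option ι) :
    wrap k (word k (l ++ [z])) = headFun k (z :: l) := by
  rw [wrap, LinearMap.comp_apply, wordLift_word, rotFun_append, wordLift_word]

theorem wrap_snocL (z : Option ι) (g : WordSpace k ι) :
    wrap k (snocL k z g) = wordLift k (headFun k) (consL k z g) := by
  have h : wrap k ∘ₗ snocL k z = wordLift k (headFun k) ∘ₗ consL k z :=
    wordSpace_hom_ext k fun l => by
      rw [LinearMap.comp_apply, snocL_word, wrap_word_append, LinearMap.comp_apply, consL_word,
        wordLift_word]
  exact LinearMap.congr_fun h g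

/-- Hochschild chains are the two-sided bar construction with its outer letters glued together. The
face of b' at the appended unit returns the word, and gluing turns it into the cyclic face; in all
other faces the unit is absorbed by the gluing. -/
theorem hochFun_eq (l : List (Option ι)) (hl : l ≠ []) :
    hochFun k l = wrap k (barFun k (l ++ [none])) := by
  have h1 : ∀ l : List (Option ι), l ≠ [] → barFun k (l ++ [none]) =
      snocL k none (barFun k l) + (-1 : k) ^ (l.length + 1) • word k l := by
    intro l hl
    induction l with
    | nil => exact absurd rfl hl
    | cons a l ih =>
      cases l with
      | nil => rcases a with _ | a <;> simp [barFun, mulHead]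
      | cons b l =>
        have e : mulHead k a b (l ++ [none]) = snocL k none (mulHead k a b l) := by
          rcases a with _ | a <;> rcases b with _ | b <;> simp [mulHead]
        have ih' := ih (by simp)
        simp only [List.cons_append] at ih' ⊢
        rw [barFun, ih', barFun, e, map_sub, map_add, map_smul, consL_word, consL_snocL,
          List.length_cons (a := a), pow_succ _ ((b :: l).length + 1), mul_neg_one, neg_smul]
        abel
  have h2 : ∀ (b : Option ι) (g : WordSpace k ι),
      wrap k (snocL k none (consL k b g)) = consL k b g := fun b g => by
    rw [wrap_snocL, head_consL_none]
  have h3 : wrap k (snocL k none (barFun k l)) = barFun k l := by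
    match l with
    | [] => simp [barFun]
    | [_] => simp [barFun]
    | a :: b :: l =>
      rw [barFun, map_sub, map_sub, h2]
      congr 1
      rcases a with _ | a <;> rcases b with _ | b <;>
        simp only [mulHead, map_zero] <;> rw [← consL_word, h2]
  rw [h1 l hl, map_add, map_smul, h3, hochFun]

/-- `htpyInner` touches neither outer letter, so it does not matter whether these are glued before
or after. -/
theorem htpy_wrap (y : WordSpace k ι) :
    wordLift k (htpyFun k) (wrap k y) = wrap k (wordLift k (htpyInner k) y) := by
  have h : wordLift k (htpyFun k) ∘ₗ wrap k =
      (wrap k ∘ₗ wordLift k (htpyInner k) : WordSpace k ι →ₗ[k] WordSpace k ι) := by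
    refine wordSpace_hom_ext k fun l => ?_
    rcases List.eq_nil_or_concat' l with rfl | ⟨l, z, rfl⟩
    · simp [wrap, rotFun, htpyInner]
    · rw [LinearMap.comp_apply, LinearMap.comp_apply, wordLift_word, htpyInner_append,
        wrap_word_append, wrap_snocL]
      cases l with
      | nil => simp [headFun, htpyFun]
      | cons a l => rw [headFun, wordLift_mulHead k (htpyFun k) (htpyFun_cons_eq k)]
  exact LinearMap.congr_fun h y

/-- This is `bar_htpyInner` for the word with a unit appended, after gluing the outer letters. -/
theorem hoch_htpy (l : List (Option ι)) (hl : l ≠ []) :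
    wordLift k (hochFun k) (htpyFun k l) + wordLift k (htpyFun k) (hochFun k l) =
      word k l - nondegFun k l := by
  obtain ⟨a, l, rfl⟩ := List.exists_cons_of_ne_nil hl
  have h1 : ∀ (b : Option ι) (g : WordSpace k ι), wordLift k (hochFun k) (consL k b g) =
      wrap k (wordLift k (barFun k) (snocL k none (consL k b g))) := by
    intro b g
    have : wordLift k (hochFun k) ∘ₗ consL k b =
        wrap k ∘ₗ wordLift k (barFun k) ∘ₗ snocL k none ∘ₗ consL k b :=
      wordSpace_hom_ext k fun l => by
        simp only [LinearMap.comp_apply, consL_word, snocL_word, wordLift_word]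
        exact hochFun_eq k _ (by simp)
    exact LinearMap.congr_fun this g
  have h2 : ∀ (b : Option ι) (g : WordSpace k ι),
      wrap k (snocL k none (consL k b g)) = consL k b g := fun b g => by
    rw [wrap_snocL, head_consL_none]
  have h3 : ∃ g, nondegFun k (a :: l) = consL k a g := by
    match l with
    | [] => exact ⟨word k [], by simp [nondegFun]⟩
    | none :: l => exact ⟨0, by simp [nondegFun]⟩
    | some x :: l => exact ⟨_, rfl⟩
  obtain ⟨g, hg⟩ := htpyFun_cons_eq k l
  obtain ⟨g', hg'⟩ := h3
  rw [hg a, h1, ← hg a, hochFun_eq k _ hl, htpy_wrap, ← htpyInner_append, ← map_add]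
  cases hm : l ++ [none] with
  | nil => simp at hm
  | cons y m =>
    rw [List.cons_append, hm, bar_htpyInner, ← hm, ← List.cons_append, nondegInner_append k _ hl,
      map_sub, hg', h2, ← snocL_word, ← consL_word, h2]

end Words

/-! ### The basis of `k[x_1, …, x_d] / 𝔪²` and of its tensor powers -/

section TruncBasis

variable (k : Type*) [CommRing k] (d : ℕ)

/-- The exponent of the monomial of a letter. -/
def letterExp {d : ℕ} : Option (Fin d) → (Fin d →₀ ℕ)
  | none => 0
  | some i => Finsupp.single i 1

/-- The weight of a letter. -/
def letterWeight {d : ℕ} : Option (Fin d) → ℕ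
  | none => 0
  | some _ => 1

theorem degree_letterExp {d : ℕ} (a : Option (Fin d)) :
    (letterExp a).degree = letterWeight a := by
  cases a <;> simp [letterExp, letterWeight]

theorem letterExp_injective {d : ℕ} : Function.Injective (letterExp (d := d)) := by
  intro a b h
  rcases a with _ | a <;> rcases b with _ | b <;> simp [letterExp] at h ⊢
  · exact (Finsupp.single_ne_zero.mpr one_ne_zero) h.symm
  · exact (Finsupp.single_left_injective one_ne_zero) h

theorem exists_letterExp {d : ℕ} (m : Fin d →₀ ℕ) (hm : m.degree < 2) :
    ∃ a, letterExp a = m := by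
  rcases Nat.eq_zero_or_pos m.degree with h | h
  · exact ⟨none, ((Finsupp.degree_eq_zero_iff m).mp h).symm⟩
  · have h1 : m.degree = 1 := by omega
    have h0 : m ≠ 0 := by rintro rfl; simp at h
    obtain ⟨i, hi⟩ := Finsupp.ne_iff.mp h0
    have hle : Finsupp.single i 1 ≤ m :=
      Finsupp.single_le_iff.mpr (Nat.one_le_iff_ne_zero.mpr hi)
    have h2 := tsub_add_cancel_of_le hle
    have h3 := congrArg Finsupp.degree h2
    rw [map_add, Finsupp.degree_single, h1] at h3
    have h4 := (Finsupp.degree_eq_zero_iff _).mp (by omega : (m - Finsupp.single i 1).degree = 0)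
    exact ⟨some i, by rw [← h2, h4, zero_add, letterExp]⟩

/-- The element of `A` named by a letter: `1` or `x_i`. -/
def letter (a : Option (Fin d)) : Trunc k d :=
  Ideal.Quotient.mk _ (MvPolynomial.monomial (letterExp a) 1)

@[simp] theorem letter_none : letter k d none = 1 := by
  simp [letter, letterExp]

/-- Membership in 𝔪² means that all coefficients of degree below 2 vanish, and the monomials of
degree below 2 are exactly those of the letters. -/
theorem mk_eq_sum_letter (p : MvPolynomial (Fin d) k) :
    (Ideal.Quotient.mk _ p : Trunc k d) =
      ∑ a : Option (Fin d), MvPolynomial.coeff (letterExp a) p • letter k d a := by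
  have e : ∀ a : Option (Fin d), MvPolynomial.coeff (letterExp a) p • letter k d a =
      (Ideal.Quotient.mk _ (MvPolynomial.coeff (letterExp a) p •
        MvPolynomial.monomial (letterExp a) 1) : Trunc k d) := fun a => rfl
  simp only [e]
  rw [← map_sum, Ideal.Quotient.mk_eq_mk_iff_sub_mem]
  refine (MvPolynomial.mem_pow_idealOfVars_iff' 2 _).mpr fun m hm => ?_
  obtain ⟨a, rfl⟩ := exists_letterExp m hm
  rw [MvPolynomial.coeff_sub, MvPolynomial.coeff_sum, Finset.sum_eq_single a]
  · simp
  · intro b _ hb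
    rw [MvPolynomial.coeff_smul, MvPolynomial.coeff_monomial,
      if_neg fun h => hb (letterExp_injective h), smul_zero]
  · simp

theorem linearIndependent_letter : LinearIndependent k (letter k d) := by
  rw [Fintype.linearIndependent_iff]
  intro c hc a
  have e : ∑ b, c b • letter k d b =
      (Ideal.Quotient.mk _ (∑ b, c b • MvPolynomial.monomial (letterExp b) 1) : Trunc k d) := by
    rw [map_sum]; rfl
  rw [e, Ideal.Quotient.eq_zero_iff_mem] at hc
  have h := (MvPolynomial.mem_pow_idealOfVars_iff' 2 _).mp hc (letterExp a)
    (by rw [degree_letterExp]; cases a <;> simp [letterWeight])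
  rw [MvPolynomial.coeff_sum, Finset.sum_eq_single a] at h
  · simpa using h
  · intro b _ hb
    rw [MvPolynomial.coeff_smul, MvPolynomial.coeff_monomial,
      if_neg fun h => hb (letterExp_injective h), smul_zero]
  · simp

/-- The basis `1, x_1, …, x_d` of `A`. -/
def letterBasis : Module.Basis (Option (Fin d)) k (Trunc k d) :=
  Module.Basis.mk (linearIndependent_letter k d) fun x _ => by
    obtain ⟨p, rfl⟩ := Ideal.Quotient.mk_surjective x
    rw [mk_eq_sum_letter]
    exact Submodule.sum_mem _ fun a _ =>
      Submodule.smul_mem _ _ (Submodule.subset_span (Set.mem_range_self a))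

@[simp] theorem letterBasis_apply (a : Option (Fin d)) :
    letterBasis k d a = letter k d a := by simp [letterBasis]

theorem letterBasis_repr_mk (p : MvPolynomial (Fin d) k) (a : Option (Fin d)) :
    (letterBasis k d).repr (Ideal.Quotient.mk _ p : Trunc k d) a =
      MvPolynomial.coeff (letterExp a) p := by
  rw [mk_eq_sum_letter]
  simp only [← letterBasis_apply]
  rw [Module.Basis.repr_sum_self]

theorem letter_mem_homPart (a : Option (Fin d)) :
    letter k d a ∈ homPart k d (letterWeight a) :=
  ⟨MvPolynomial.monomial (letterExp a) 1,
    MvPolynomial.isHomogeneous_monomial _ (degree_letterExp a), rfl⟩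

theorem repr_eq_zero_of_mem_homPart {e : ℕ} {x : Trunc k d} (hx : x ∈ homPart k d e)
    {a : Option (Fin d)} (ha : letterWeight a ≠ e) : (letterBasis k d).repr x a = 0 := by
  obtain ⟨p, hp, rfl⟩ := hx
  have h := letterBasis_repr_mk k d p a
  by_contra hne
  have h1 : MvPolynomial.coeff (letterExp a) p ≠ 0 := by
    rw [← h]; exact hne
  have h2 : (letterExp a).degree = e := by
    rw [Finsupp.degree_eq_weight_one]; exact hp h1
  exact ha ((degree_letterExp a).symm.trans h2)

theorem letter_some_mul_some (i j : Fin d) :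
    letter k d (some i) * letter k d (some j) = 0 := by
  rw [letter, letter, ← map_mul, Ideal.Quotient.eq_zero_iff_mem]
  refine (MvPolynomial.mem_pow_idealOfVars_iff' 2 _).mpr fun m hm => ?_
  rw [MvPolynomial.monomial_mul, MvPolynomial.coeff_monomial, if_neg]
  rintro rfl
  simp [letterExp] at hm

/-- The basis of the tensor powers of `A` consisting of the words. -/
def chainBasis (q : ℕ) : Module.Basis (Fin (q + 1) → Option (Fin d)) k (Chain k (Trunc k d) q) :=
  Basis.piTensorProduct fun _ => letterBasis k d

theorem chainBasis_apply (q : ℕ) (u : Fin (q + 1) → Option (Fin d)) :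
    chainBasis k d q u = PiTensorProduct.tprod k fun i => letter k d (u i) := by
  simp [chainBasis]

/-- The weight of a word. -/
def wordWeight {d m : ℕ} (u : Fin m → Option (Fin d)) : ℕ := ∑ i, letterWeight (u i)

/-- A homogeneous element has coordinates only at letters of its own weight. As the weight part is
spanned by basis vectors, later claims about it can be checked word by word. -/
theorem weightPart_eq_span (w q : ℕ) :
    weightPart k d w q = Submodule.span k (chainBasis k d q '' {u | wordWeight u = w}) := by
  apply le_antisymm
  · refine Submodule.span_le.mpr ?_
    rintro _ ⟨e, a, ha, he, rfl⟩
    rw [SetLike.mem_coe, Module.Basis.mem_span_image]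
    intro u hu
    have hu' : ∏ i, (letterBasis k d).repr (a i) (u i) ≠ 0 := by
      rw [← Basis.piTensorProduct_repr_tprod_apply]
      exact Finsupp.mem_support_iff.mp hu
    have h : ∀ i, letterWeight (u i) = e i := by
      intro i
      by_contra hne
      exact hu' (Finset.prod_eq_zero (Finset.mem_univ i)
        (repr_eq_zero_of_mem_homPart k d (ha i) hne))
    change wordWeight u = w
    simp only [wordWeight, h, he]
  · refine Submodule.span_le.mpr ?_
    rintro _ ⟨u, hu, rfl⟩
    exact Submodule.subset_span ⟨_, _, fun i => letter_mem_homPart k d (u i), hu,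
      chainBasis_apply k d q u⟩

end TruncBasis

/-! ### The extra degeneracy -/

section ExtraDegeneracy

variable (k : Type*) [CommRing k] (A : Type*) [Ring A] [Algebra k A]

variable {A} in
/-- The map `x ↦ a ⊗ x`. -/
def consMap (a : A) (n : ℕ) : Chain k A n →ₗ[k] Chain k A (n + 1) :=
  PiTensorProduct.lift ((PiTensorProduct.tprod k (s := fun _ : Fin (n + 2) => A)).curryLeft a)

variable {A} in
@[simp] theorem consMap_tprod (a : A) (n : ℕ) (v : Fin (n + 1) → A) :
    consMap k a n (PiTensorProduct.tprod k v) =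
      PiTensorProduct.tprod k (Fin.cons a v : Fin (n + 2) → A) := by
  simp [consMap]

variable {A} in
theorem face_succ_comp_consMap (a : A) (n i : ℕ) (hi : i ≤ n) :
    face k A (n + 1) (i + 1) ∘ₗ consMap k a (n + 1) = consMap k a n ∘ₗ face k A n i := by
  apply PiTensorProduct.ext
  ext v
  simp only [LinearMap.compMultilinearMap_apply, LinearMap.comp_apply, consMap_tprod, face_tprod]
  congr 1
  funext j
  have h1 : i + 1 ≤ n + 1 := by omega
  refine Fin.cases ?_ (fun j => ?_) j
  · simp [faceFun, h1]
  · simp only [faceFun, h1, hi, if_true, Fin.cons_succ, Fin.val_succ, Nat.add_lt_add_iff_right,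
      Nat.add_right_cancel_iff, ← Fin.succ_castSucc]

theorem face_zero_comp_consMap_one (n : ℕ) :
    face k A n 0 ∘ₗ consMap k (1 : A) n = LinearMap.id := by
  apply PiTensorProduct.ext
  ext v
  simp only [LinearMap.compMultilinearMap_apply, LinearMap.comp_apply, consMap_tprod, face_tprod,
    LinearMap.id_apply]
  congr 1
  funext j
  refine Fin.cases ?_ (fun j => ?_) j <;> simp [faceFun]

theorem face_last_comp_consMap_one (n : ℕ) :
    face k A n (n + 1) ∘ₗ consMap k (1 : A) n = rot k A n := by
  apply PiTensorProduct.ext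
  ext v
  simp only [LinearMap.compMultilinearMap_apply, LinearMap.comp_apply, consMap_tprod, face_tprod,
    rot_tprod]
  congr 1
  funext j
  have h : ¬ n + 1 ≤ n := by omega
  refine Fin.cases ?_ (fun j => ?_) j
  · simp only [faceFun, h, if_false, if_true, ← Fin.succ_last, Fin.cons_succ, Fin.cons_zero,
      mul_one]
    congr 1
  · simp only [faceFun, h, if_false, Fin.succ_ne_zero, ← Fin.succ_castSucc, Fin.cons_succ]
    congr 1
    ext
    rw [finRotate_symm_val]; simp

variable {A} in
-- A new front factor shifts the face index by one and so reverses the sign; only d_0 is left over.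
-- For a = 1 this gives the contraction of the odd columns, for a letter the recursion defining
-- `barFun`.
theorem bMap'_comp_consMap (a : A) (n : ℕ) :
    bMap' k A (n + 1) ∘ₗ consMap k a (n + 1) =
      face k A (n + 1) 0 ∘ₗ consMap k a (n + 1) - consMap k a n ∘ₗ bMap' k A n := by
  rw [bMap', bMap', Finset.sum_range_succ', LinearMap.add_comp, pow_zero, one_smul,
    sub_eq_add_neg, add_comm (LinearMap.comp _ _) (LinearMap.comp (face k A (n + 1) 0) _), sum_comp_lin, comp_sum_lin, ← Finset.sum_neg_distrib]
  congr 1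
  refine Finset.sum_congr rfl fun i hi => ?_
  rw [LinearMap.smul_comp, LinearMap.comp_smul,
    face_succ_comp_consMap k a n i (by simpa [Nat.lt_succ_iff] using hi), pow_succ, mul_neg_one,
    neg_smul_lin]

theorem bMap'_consMap_one_zero (x : Chain k A 0) : bMap' k A 0 (consMap k 1 0 x) = x := by
  have h := LinearMap.congr_fun (face_zero_comp_consMap_one k A 0) x
  simpa [bMap'] using h

theorem bMap'_consMap_one (n : ℕ) (x : Chain k A (n + 1)) :
    bMap' k A (n + 1) (consMap k 1 (n + 1) x) + consMap k 1 n (bMap' k A n x) = x := by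
  have h := LinearMap.congr_fun (bMap'_comp_consMap k (1 : A) n) x
  rw [face_zero_comp_consMap_one] at h
  simp only [LinearMap.comp_apply, LinearMap.sub_apply, LinearMap.id_apply] at h
  rw [h, sub_add_cancel]

theorem bMap_consMap_one (n : ℕ) (x : Chain k A n) :
    bMap k A n (consMap k 1 n x) = bMap' k A n (consMap k 1 n x) - tMap k A n x := by
  have h := LinearMap.congr_fun (face_last_comp_consMap_one k A n) x
  rw [LinearMap.comp_apply] at h
  rw [bMap, Finset.sum_range_succ, ← bMap', LinearMap.add_apply, LinearMap.smul_apply, h, tMap,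
    LinearMap.smul_apply, pow_succ, mul_neg_one, neg_smul, sub_eq_add_neg]

end ExtraDegeneracy

/-! ### Chains as combinations of words -/

section Transfer

variable (k : Type*) [CommRing k] (d : ℕ)

/-- A chain as a combination of words. -/
def toWord (q : ℕ) : Chain k (Trunc k d) q →ₗ[k] WordSpace k (Fin d) :=
  (chainBasis k d q).constr k fun u => word k (List.ofFn u)

/-- The chain of a combination of words of length `q + 1`. -/
def ofWord (q : ℕ) : WordSpace k (Fin d) →ₗ[k] Chain k (Trunc k d) q :=
  Finsupp.linearCombination k fun l => chainBasis k d q fun i => l.getD i none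

@[simp] theorem toWord_chainBasis (q : ℕ) (u : Fin (q + 1) → Option (Fin d)) :
    toWord k d q (chainBasis k d q u) = word k (List.ofFn u) := by
  simp [toWord, -List.ofFn_succ]

theorem ofWord_word (q : ℕ) (l : List (Option (Fin d))) :
    ofWord k d q (word k l) = chainBasis k d q fun i => l.getD i none := by
  simp [ofWord]

@[simp] theorem ofWord_word_ofFn (q : ℕ) (u : Fin (q + 1) → Option (Fin d)) :
    ofWord k d q (word k (List.ofFn u)) = chainBasis k d q u := by
  rw [ofWord_word]
  congr 1
  funext i
  have hi := i.is_le
  simp [hi, -List.ofFn_succ]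

theorem ofWord_toWord (q : ℕ) (x : Chain k (Trunc k d) q) :
    ofWord k d q (toWord k d q x) = x := by
  have h : ofWord k d q ∘ₗ toWord k d q = LinearMap.id :=
    (chainBasis k d q).ext fun u => by simp [-List.ofFn_succ]
  exact LinearMap.congr_fun h x

/-- The length condition is essential: `ofWord` truncates longer words and pads shorter ones with
units. -/
theorem toWord_ofWord (q : ℕ) {y : WordSpace k (Fin d)}
    (hy : y ∈ Finsupp.supported k k {l : List (Option (Fin d)) | l.length = q + 1}) :
    toWord k d q (ofWord k d q y) = y := by
  suffices h : Finsupp.supported k k {l : List (Option (Fin d)) | l.length = q + 1} ≤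
      LinearMap.eqLocus (toWord k d q ∘ₗ ofWord k d q) LinearMap.id from h hy
  rw [Finsupp.supported_eq_span_single, Submodule.span_le]
  rintro _ ⟨l, hl, rfl⟩
  rw [SetLike.mem_coe, LinearMap.mem_eqLocus, LinearMap.comp_apply, ofWord_word,
    toWord_chainBasis, LinearMap.id_apply]
  congr 1
  refine List.ext_getElem (by simpa using hl.symm) fun i h1 h2 => ?_
  simp [h2, -List.ofFn_succ]

theorem letter_mul (a b : Option (Fin d)) : letter k d a * letter k d b =
    match a, b with
    | none, b => letter k d b
    | some i, none => letter k d (some i)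
    | some _, some _ => 0 := by
  rcases a with _ | a <;> rcases b with _ | b <;> simp [letter_some_mul_some]

theorem consMap_chainBasis (a : Option (Fin d)) (q : ℕ) (u : Fin (q + 1) → Option (Fin d)) :
    consMap k (letter k d a) q (chainBasis k d q u) =
      chainBasis k d (q + 1) (Fin.cons a u : Fin (q + 2) → Option (Fin d)) := by
  rw [chainBasis_apply, chainBasis_apply, consMap_tprod]
  congr 1
  funext j
  refine Fin.cases ?_ (fun j => ?_) j <;> simp

theorem toWord_consMap (a : Option (Fin d)) (q : ℕ) (x : Chain k (Trunc k d) q) :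
    toWord k d (q + 1) (consMap k (letter k d a) q x) = consL k a (toWord k d q x) := by
  have h : toWord k d (q + 1) ∘ₗ consMap k (letter k d a) q = consL k a ∘ₗ toWord k d q :=
    (chainBasis k d q).ext fun u => by
      simp only [LinearMap.comp_apply, consMap_chainBasis, toWord_chainBasis, consL_word,
        List.ofFn_cons]
  exact LinearMap.congr_fun h x

theorem toWord_face_zero (q : ℕ) (x : Chain k (Trunc k d) (q + 1)) :
    toWord k d q (face k (Trunc k d) q 0 x) = wordLift k (headFun k) (toWord k d (q + 1) x) := by
  have h : toWord k d q ∘ₗ face k (Trunc k d) q 0 =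
      wordLift k (headFun k) ∘ₗ toWord k d (q + 1) := by
    refine (chainBasis k d (q + 1)).ext fun u => ?_
    obtain ⟨a, u, rfl⟩ : ∃ a u', u = (Fin.cons a u' : Fin (q + 2) → Option (Fin d)) :=
      ⟨u 0, Fin.tail u, (Fin.cons_self_tail u).symm⟩
    obtain ⟨b, u, rfl⟩ : ∃ b u', u = (Fin.cons b u' : Fin (q + 1) → Option (Fin d)) :=
      ⟨u 0, Fin.tail u, (Fin.cons_self_tail u).symm⟩
    have e : ∀ c : Option (Fin d), letter k d a * letter k d b = letter k d c →
        (faceFun 0 fun i => letter k d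
          ((Fin.cons a (Fin.cons b u : Fin (q + 1) → Option (Fin d)) :
            Fin (q + 2) → Option (Fin d)) i)) =
          fun i => letter k d ((Fin.cons c u : Fin (q + 1) → Option (Fin d)) i) := by
      intro c hc
      funext j
      refine Fin.cases ?_ (fun j => ?_) j
      · simpa [faceFun] using hc
      · simp [faceFun]
    simp only [LinearMap.comp_apply, toWord_chainBasis, List.ofFn_cons, wordLift_word, headFun]
    rw [chainBasis_apply, face_tprod]
    have hab := letter_mul k d a b
    rcases a with _ | a
    · rw [e b hab, ← chainBasis_apply, toWord_chainBasis, List.ofFn_cons, mulHead]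
    · rcases b with _ | b
      · rw [e _ hab, ← chainBasis_apply, toWord_chainBasis, List.ofFn_cons, mulHead]
      -- The product of two generators is zero, so the pure tensor has a zero factor in front.
      · rw [MultilinearMap.map_coord_zero _ 0, map_zero, mulHead]
        simpa [faceFun] using hab
  exact LinearMap.congr_fun h x

theorem toWord_rot (q : ℕ) (x : Chain k (Trunc k d) q) :
    toWord k d q (rot k (Trunc k d) q x) = wordLift k (rotFun k) (toWord k d q x) := by
  have h : toWord k d q ∘ₗ rot k (Trunc k d) q = wordLift k (rotFun k) ∘ₗ toWord k d q := by
    refine (chainBasis k d q).ext fun u => ?_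
    obtain ⟨u, a, rfl⟩ : ∃ u' a, u = (Fin.snoc u' a : Fin (q + 1) → Option (Fin d)) :=
      ⟨Fin.init u, u (Fin.last q), (Fin.snoc_init_self u).symm⟩
    simp only [LinearMap.comp_apply, toWord_chainBasis, wordLift_word, List.ofFn_succ',
      Fin.snoc_castSucc, Fin.snoc_last, List.concat_eq_append, rotFun_append]
    rw [chainBasis_apply, rot_tprod,
      ← chainBasis_apply k d q fun i => (Fin.snoc u a : Fin (q + 1) → Option (Fin d)) _,
      toWord_chainBasis, ← List.ofFn_cons]
    congr 2
    funext j
    refine Fin.cases ?_ (fun j => ?_) j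
    · have e : (finRotate (q + 1)).symm 0 = Fin.last q :=
        Fin.ext (by rw [finRotate_symm_val]; simp)
      rw [e]; simp
    · have e : (finRotate (q + 1)).symm j.succ = j.castSucc :=
        Fin.ext (by rw [finRotate_symm_val]; simp)
      rw [e]; simp
  exact LinearMap.congr_fun h x

theorem toWord_bMap' (q : ℕ) (x : Chain k (Trunc k d) (q + 1)) :
    toWord k d q (bMap' k (Trunc k d) q x) = wordLift k (barFun k) (toWord k d (q + 1) x) := by
  suffices h : toWord k d q ∘ₗ bMap' k (Trunc k d) q =
      wordLift k (barFun k) ∘ₗ toWord k d (q + 1) from LinearMap.congr_fun h x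
  clear x
  induction q with
  | zero =>
    refine LinearMap.ext fun x => ?_
    have h1 : bMap' k (Trunc k d) 0 x = face k (Trunc k d) 0 0 x := by simp [bMap']
    rw [LinearMap.comp_apply, LinearMap.comp_apply, h1, toWord_face_zero]
    suffices h : wordLift k (headFun k) ∘ₗ toWord k d 1 =
        wordLift k (barFun k) ∘ₗ toWord k d 1 from LinearMap.congr_fun h x
    exact (chainBasis k d 1).ext fun u => by simp [headFun, barFun]
  | succ q ih =>
    refine (chainBasis k d (q + 2)).ext fun u => ?_
    obtain ⟨a, u, rfl⟩ : ∃ a u', u = (Fin.cons a u' : Fin (q + 3) → Option (Fin d)) :=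
      ⟨u 0, Fin.tail u, (Fin.cons_self_tail u).symm⟩
    have h := LinearMap.congr_fun (bMap'_comp_consMap k (letter k d a) q)
      (chainBasis k d (q + 1) u)
    have ih' := LinearMap.congr_fun ih (chainBasis k d (q + 1) u)
    simp only [LinearMap.comp_apply, LinearMap.sub_apply] at h ih' ⊢
    rw [← consMap_chainBasis, h, map_sub, toWord_face_zero, toWord_consMap, toWord_consMap, ih',
      toWord_chainBasis, wordLift_word, consL_word, wordLift_word, wordLift_word,
      List.ofFn_succ, barFun, headFun]

theorem toWord_bMap (q : ℕ) (x : Chain k (Trunc k d) (q + 1)) :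
    toWord k d q (bMap k (Trunc k d) q x) = wordLift k (hochFun k) (toWord k d (q + 1) x) := by
  suffices h : toWord k d q ∘ₗ bMap k (Trunc k d) q =
      wordLift k (hochFun k) ∘ₗ toWord k d (q + 1) from LinearMap.congr_fun h x
  refine (chainBasis k d (q + 1)).ext fun u => ?_
  rw [bMap_eq, LinearMap.comp_apply, LinearMap.add_apply, map_add, toWord_bMap',
    LinearMap.comp_apply, LinearMap.comp_apply, toWord_face_zero, tMap, LinearMap.smul_apply,
    map_smul, map_smul, toWord_rot, toWord_chainBasis, wordLift_word, wordLift_word (hochFun k),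
    hochFun, List.length_ofFn, wrap, LinearMap.comp_apply, pow_succ _ (q + 1 + 1), pow_succ _ (q + 1),
    mul_assoc, neg_one_mul, neg_neg, mul_one]

end Transfer

/-! ### The homotopy for the Hochschild boundary -/

section Homotopy

variable (k : Type*) [CommRing k] (d : ℕ)

/-- The length statement allows passing back from words to chains without loss; the weight statement
keeps the homotopy inside a weight part. -/
theorem htpyFun_mem (l : List (Option (Fin d))) :
    htpyFun k l ∈ Finsupp.supported k k {m : List (Option (Fin d)) |
      m.length = l.length + 1 ∧ (m.map letterWeight).sum = (l.map letterWeight).sum} := by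
  have hc : ∀ (a : Option (Fin d)) (l : List (Option (Fin d))) (g : WordSpace k (Fin d)),
      g ∈ Finsupp.supported k k {m : List (Option (Fin d)) |
        m.length = l.length + 1 ∧ (m.map letterWeight).sum = (l.map letterWeight).sum} →
      consL k a g ∈ Finsupp.supported k k {m : List (Option (Fin d)) |
        m.length = (a :: l).length + 1 ∧
          (m.map letterWeight).sum = ((a :: l).map letterWeight).sum} := by
    intro a l g hg
    rw [← Submodule.mem_comap]
    revert g
    rw [← SetLike.le_def, Finsupp.supported_eq_span_single, Submodule.span_le]
    rintro _ ⟨m, ⟨h1, h2⟩, rfl⟩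
    rw [SetLike.mem_coe, Submodule.mem_comap, consL_word]
    exact Finsupp.single_mem_supported k _ ⟨by simp [h1], by simp [h2]⟩
  induction l with
  | nil => simp [htpyFun]
  | cons a l ih =>
    match l, ih with
    | [], _ => simp [htpyFun]
    | none :: l, _ =>
      rw [htpyFun]
      split_ifs
      · exact Finsupp.single_mem_supported k _ ⟨by simp, by simp [letterWeight]⟩
      · exact Submodule.zero_mem _
    | some x :: l, ih => exact Submodule.neg_mem _ (hc a _ _ ih)

theorem nondegFun_eq {ι : Type*} (a : Option ι) (l : List (Option ι)) :
    nondegFun k (a :: l) = open Classical in if none ∈ l then 0 else word k (a :: l) := by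
  induction l generalizing a with
  | nil => simp [nondegFun]
  | cons b l ih =>
    rcases b with _ | b
    · simp [nondegFun]
    · rw [nondegFun, ih]
      by_cases h : none ∈ l <;> simp [h]

/-- The contracting homotopy of the degenerate part of the Hochschild complex. -/
def htpy (q : ℕ) : Chain k (Trunc k d) q →ₗ[k] Chain k (Trunc k d) (q + 1) :=
  ofWord k d (q + 1) ∘ₗ wordLift k (htpyFun k) ∘ₗ toWord k d q

open Classical in
/-- The projection to the words without unit letters after the first letter. -/
def nondeg (q : ℕ) : Chain k (Trunc k d) q →ₗ[k] Chain k (Trunc k d) q :=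
  (chainBasis k d q).constr k fun u =>
    if ∃ i : Fin q, u i.succ = none then 0 else chainBasis k d q u

open Classical in
/-- The map `1 ⊗ v ↦ v` on the words `v` without unit letters; all other words go to zero. -/
def tailMap (q : ℕ) : Chain k (Trunc k d) (q + 1) →ₗ[k] Chain k (Trunc k d) q :=
  (chainBasis k d (q + 1)).constr k fun u =>
    if u 0 = none ∧ ¬ ∃ i : Fin (q + 1), u i.succ = none then chainBasis k d q (Fin.tail u) else 0

theorem htpy_mem_weightPart {w q : ℕ} {x : Chain k (Trunc k d) q} (hx : x ∈ weightPart k d w q) :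
    htpy k d q x ∈ weightPart k d w (q + 1) := by
  suffices h : weightPart k d w q ≤ (weightPart k d w (q + 1)).comap (htpy k d q) from h hx
  rw [weightPart_eq_span k d w q, Submodule.span_le]
  rintro _ ⟨u, hu, rfl⟩
  rw [SetLike.mem_coe, Submodule.mem_comap, htpy, LinearMap.comp_apply, LinearMap.comp_apply,
    toWord_chainBasis, wordLift_word, ← Submodule.mem_comap]
  refine SetLike.le_def.mp ?_ (htpyFun_mem k d (List.ofFn u))
  rw [Finsupp.supported_eq_span_single, Submodule.span_le]
  rintro _ ⟨m, ⟨h1, h2⟩, rfl⟩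
  rw [SetLike.mem_coe, Submodule.mem_comap, ofWord_word, weightPart_eq_span]
  refine Submodule.subset_span ⟨_, ?_, rfl⟩
  have h3 : ((List.ofFn u).map letterWeight).sum = w := by
    rw [List.map_ofFn, List.sum_ofFn]; exact hu
  rw [h3] at h2
  rw [List.length_ofFn] at h1
  change ∑ i : Fin (q + 2), letterWeight (m.getD i none) = w
  rw [← h2, ← List.sum_ofFn]
  congr 1
  refine List.ext_getElem (by simp [h1]) fun i h3 h4 => ?_
  rw [List.length_map] at h4
  simp [h4, -List.ofFn_succ]

theorem consMap_one_mem_weightPart {w q : ℕ} {x : Chain k (Trunc k d) q}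
    (hx : x ∈ weightPart k d w q) : consMap k 1 q x ∈ weightPart k d w (q + 1) := by
  suffices h : weightPart k d w q ≤ (weightPart k d w (q + 1)).comap (consMap k 1 q) from h hx
  rw [weightPart_eq_span k d w q, weightPart_eq_span k d w (q + 1), Submodule.span_le]
  rintro _ ⟨u, hu, rfl⟩
  rw [SetLike.mem_coe, Submodule.mem_comap, ← letter_none, consMap_chainBasis]
  refine Submodule.subset_span ⟨_, ?_, rfl⟩
  change ∑ i, _ = w
  rw [Fin.sum_univ_succ]
  exact (zero_add _).trans hu

theorem letterWeight_le_one {d : ℕ} (a : Option (Fin d)) : letterWeight a ≤ 1 := by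
  cases a <;> simp [letterWeight]

theorem letterWeight_eq_one {d : ℕ} {a : Option (Fin d)} : letterWeight a = 1 ↔ a ≠ none := by
  cases a <;> simp [letterWeight]

theorem wordWeight_le {d m : ℕ} (u : Fin m → Option (Fin d)) : wordWeight u ≤ m := by
  refine (Finset.sum_le_sum fun i _ => letterWeight_le_one (u i)).trans ?_
  simp

theorem wordWeight_eq_iff {d m : ℕ} (u : Fin m → Option (Fin d)) :
    wordWeight u = m ↔ ∀ i, u i ≠ none := by
  have h := Finset.sum_eq_sum_iff_of_le (s := Finset.univ)
    fun i _ => letterWeight_le_one (u i)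
  simp only [Finset.sum_const, Finset.card_univ, Fintype.card_fin, smul_eq_mul, mul_one,
    Finset.mem_univ, true_imp_iff, letterWeight_eq_one] at h
  exact h

theorem wordWeight_succ {d m : ℕ} (u : Fin (m + 1) → Option (Fin d)) :
    wordWeight u = letterWeight (u 0) + wordWeight (Fin.tail u) := Fin.sum_univ_succ _

theorem weightPart_eq_bot {w q : ℕ} (h : q + 1 < w) : weightPart k d w q = ⊥ := by
  rw [weightPart_eq_span, Submodule.span_eq_bot]
  rintro _ ⟨u, hu, rfl⟩
  have := wordWeight_le u
  change wordWeight u = w at hu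
  omega

theorem nondeg_chainBasis (q : ℕ) (u : Fin (q + 1) → Option (Fin d)) :
    nondeg k d q (chainBasis k d q u) =
      open Classical in if ∃ i : Fin q, u i.succ = none then 0 else chainBasis k d q u := by
  rw [nondeg, Module.Basis.constr_basis]

theorem tailMap_chainBasis (q : ℕ) (u : Fin (q + 2) → Option (Fin d)) :
    tailMap k d q (chainBasis k d (q + 1) u) =
      open Classical in if u 0 = none ∧ ¬ ∃ i : Fin (q + 1), u i.succ = none then
        chainBasis k d q (Fin.tail u) else 0 := by
  rw [tailMap, Module.Basis.constr_basis]

theorem ofWord_nondegFun (q : ℕ) (x : Chain k (Trunc k d) q) :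
    ofWord k d q (wordLift k (nondegFun k) (toWord k d q x)) = nondeg k d q x := by
  suffices h : ofWord k d q ∘ₗ wordLift k (nondegFun k) ∘ₗ toWord k d q = nondeg k d q from
    LinearMap.congr_fun h x
  refine (chainBasis k d q).ext fun u => ?_
  rw [LinearMap.comp_apply, LinearMap.comp_apply, toWord_chainBasis, wordLift_word,
    List.ofFn_succ, nondegFun_eq, nondeg_chainBasis]
  have e : none ∈ List.ofFn (fun i => u i.succ) ↔ ∃ i : Fin q, u i.succ = none := by
    rw [List.mem_ofFn]
  by_cases h : ∃ i : Fin q, u i.succ = none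
  · rw [if_pos h, if_pos (e.mpr h), map_zero]
  · rw [if_neg h, if_neg (mt e.mp h), ← List.ofFn_succ (f := u), ofWord_word_ofFn]

theorem toWord_htpy (q : ℕ) (x : Chain k (Trunc k d) q) :
    toWord k d (q + 1) (htpy k d q x) = wordLift k (htpyFun k) (toWord k d q x) := by
  suffices h : toWord k d (q + 1) ∘ₗ htpy k d q = wordLift k (htpyFun k) ∘ₗ toWord k d q from
    LinearMap.congr_fun h x
  refine (chainBasis k d q).ext fun u => ?_
  rw [LinearMap.comp_apply, htpy, LinearMap.comp_apply, LinearMap.comp_apply, toWord_chainBasis,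
    wordLift_word]
  exact toWord_ofWord k d (q + 1) (Finsupp.supported_mono (by rintro m ⟨hm, -⟩; simpa using hm)
    (htpyFun_mem k d (List.ofFn u)))

/-- The homotopy formula in positive degrees. -/
theorem bMap_htpy_succ (q : ℕ) (x : Chain k (Trunc k d) (q + 1)) :
    bMap k (Trunc k d) (q + 1) (htpy k d (q + 1) x) + htpy k d q (bMap k (Trunc k d) q x) =
      x - nondeg k d (q + 1) x := by
  rw [← ofWord_toWord k d (q + 1) (bMap k (Trunc k d) (q + 1) (htpy k d (q + 1) x)), toWord_bMap,
    toWord_htpy, htpy, LinearMap.comp_apply, LinearMap.comp_apply, toWord_bMap, ← map_add,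
    ← ofWord_nondegFun]
  conv_rhs => enter [1]; rw [← ofWord_toWord k d (q + 1) x]
  rw [← map_sub]
  congr 1
  suffices h : wordLift k (hochFun k) ∘ₗ wordLift k (htpyFun k) ∘ₗ toWord k d (q + 1) +
      wordLift k (htpyFun k) ∘ₗ wordLift k (hochFun k) ∘ₗ toWord k d (q + 1) =
      toWord k d (q + 1) - wordLift k (nondegFun k) ∘ₗ toWord k d (q + 1) from
    LinearMap.congr_fun h x
  refine (chainBasis k d (q + 1)).ext fun u => ?_
  simp only [LinearMap.add_apply, LinearMap.sub_apply, LinearMap.comp_apply, toWord_chainBasis,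
    wordLift_word]
  exact hoch_htpy k _ (by simp)

/-- The homotopy formula in degree zero. -/
theorem bMap_htpy_zero (x : Chain k (Trunc k d) 0) :
    bMap k (Trunc k d) 0 (htpy k d 0 x) = x - nondeg k d 0 x := by
  have h : bMap k (Trunc k d) 0 ∘ₗ htpy k d 0 = LinearMap.id - nondeg k d 0 := by
    refine (chainBasis k d 0).ext fun u => ?_
    rw [LinearMap.sub_apply, nondeg_chainBasis, if_neg (by simp), LinearMap.comp_apply, htpy,
      LinearMap.comp_apply, LinearMap.comp_apply, toWord_chainBasis, wordLift_word]
    simp [htpyFun]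
  exact LinearMap.congr_fun h x

/-- The projection is 1 - (bh + hb), and b² = 0. -/
theorem bMap_nondeg (q : ℕ) (x : Chain k (Trunc k d) (q + 1)) :
    bMap k (Trunc k d) q (nondeg k d (q + 1) x) = nondeg k d q (bMap k (Trunc k d) q x) := by
  have h1 := congrArg (bMap k (Trunc k d) q) (bMap_htpy_succ k d q x)
  have hbb : ∀ (q : ℕ) (y : Chain k (Trunc k d) (q + 2)),
      bMap k (Trunc k d) q (bMap k (Trunc k d) (q + 1) y) = 0 := fun q y =>
    LinearMap.congr_fun (bMap_comp_bMap k (Trunc k d) q) y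
  rw [map_add, hbb, zero_add, map_sub] at h1
  have h2 : bMap k (Trunc k d) q (htpy k d q (bMap k (Trunc k d) q x)) =
      bMap k (Trunc k d) q x - nondeg k d q (bMap k (Trunc k d) q x) := by
    cases q with
    | zero => exact bMap_htpy_zero k d _
    | succ q =>
      have h3 := bMap_htpy_succ k d q (bMap k (Trunc k d) (q + 1) x)
      rwa [hbb, map_zero, add_zero] at h3
  rw [h2] at h1
  exact (sub_right_injective h1).symm

/-- A word of q + 1 letters with no unit after the first has q or q + 1 generators, so only two rows
contribute to a given weight. -/
theorem nondeg_eq_zero {w q : ℕ} (h1 : q ≠ w) (h2 : q + 1 ≠ w) {x : Chain k (Trunc k d) q}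
    (hx : x ∈ weightPart k d w q) : nondeg k d q x = 0 := by
  suffices h : weightPart k d w q ≤ LinearMap.ker (nondeg k d q) from h hx
  rw [weightPart_eq_span, Submodule.span_le]
  rintro _ ⟨u, hu, rfl⟩
  rw [SetLike.mem_coe, LinearMap.mem_ker, nondeg_chainBasis, if_pos]
  by_contra hne
  push Not at hne
  have h3 := (wordWeight_eq_iff (Fin.tail u)).mpr hne
  have h4 := wordWeight_succ u
  have h5 := letterWeight_le_one (u 0)
  change wordWeight u = w at hu
  omega

theorem nondeg_eq_self {q : ℕ} {x : Chain k (Trunc k d) q}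
    (hx : x ∈ weightPart k d (q + 1) q) : nondeg k d q x = x := by
  suffices h : weightPart k d (q + 1) q ≤ LinearMap.eqLocus (nondeg k d q) LinearMap.id from h hx
  rw [weightPart_eq_span, Submodule.span_le]
  rintro _ ⟨u, hu, rfl⟩
  have h := (wordWeight_eq_iff u).mp hu
  rw [SetLike.mem_coe, LinearMap.mem_eqLocus, nondeg_chainBasis, if_neg]
  · rfl
  · rintro ⟨i, hi⟩; exact h _ hi

/-- By weight, each word here contains exactly one unit, and it survives only if that unit comes
first. -/
theorem nondeg_eq_consMap_tailMap {q : ℕ} {x : Chain k (Trunc k d) (q + 1)}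
    (hx : x ∈ weightPart k d (q + 1) (q + 1)) :
    nondeg k d (q + 1) x = consMap k 1 q (tailMap k d q x) := by
  suffices h : weightPart k d (q + 1) (q + 1) ≤
      LinearMap.eqLocus (nondeg k d (q + 1)) (consMap k 1 q ∘ₗ tailMap k d q) from h hx
  rw [weightPart_eq_span, Submodule.span_le]
  rintro _ ⟨u, hu, rfl⟩
  rw [SetLike.mem_coe, LinearMap.mem_eqLocus, LinearMap.comp_apply, nondeg_chainBasis,
    tailMap_chainBasis]
  by_cases h : ∃ i : Fin (q + 1), u i.succ = none
  · rw [if_pos h, if_neg fun h' => h'.2 h, map_zero]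
  · have h' := h
    push Not at h'
    have h3 := (wordWeight_eq_iff (Fin.tail u)).mpr h'
    have h4 := wordWeight_succ u
    change wordWeight u = q + 1 at hu
    have h5 : u 0 = none := by
      by_contra h0
      have := letterWeight_eq_one.mpr h0
      omega
    rw [if_neg h, if_pos ⟨h5, h⟩, ← letter_none, consMap_chainBasis, ← h5, Fin.cons_self_tail]

theorem tailMap_consMap {q : ℕ} {x : Chain k (Trunc k d) q}
    (hx : x ∈ weightPart k d (q + 1) q) : tailMap k d q (consMap k 1 q x) = x := by
  suffices h : weightPart k d (q + 1) q ≤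
      LinearMap.eqLocus (tailMap k d q ∘ₗ consMap k 1 q) LinearMap.id from h hx
  rw [weightPart_eq_span, Submodule.span_le]
  rintro _ ⟨u, hu, rfl⟩
  have h := (wordWeight_eq_iff u).mp hu
  rw [SetLike.mem_coe, LinearMap.mem_eqLocus, LinearMap.comp_apply, ← letter_none,
    consMap_chainBasis, tailMap_chainBasis, if_pos]
  · simp
  · exact ⟨by simp, by rintro ⟨i, hi⟩; exact h i (by simpa using hi)⟩

theorem rot_chainBasis (q : ℕ) (u : Fin (q + 1) → Option (Fin d)) :
    rot k (Trunc k d) q (chainBasis k d q u) =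
      chainBasis k d q fun i => u ((finRotate (q + 1)).symm i) := by
  rw [chainBasis_apply, chainBasis_apply, rot_tprod]

/-- Rotation moves the front unit to the second place, where it makes the word degenerate. -/
theorem tailMap_tMap_consMap (q : ℕ) (x : Chain k (Trunc k d) q) :
    tailMap k d q (tMap k (Trunc k d) (q + 1) (consMap k 1 q x)) = 0 := by
  suffices h : tailMap k d q ∘ₗ tMap k (Trunc k d) (q + 1) ∘ₗ consMap k 1 q = 0 from
    LinearMap.congr_fun h x
  refine (chainBasis k d q).ext fun u => ?_
  rw [LinearMap.comp_apply, LinearMap.comp_apply, ← letter_none, consMap_chainBasis, tMap,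
    LinearMap.smul_apply, map_smul, rot_chainBasis, tailMap_chainBasis, if_neg, smul_zero,
    LinearMap.zero_apply]
  rintro ⟨-, h⟩
  refine h ⟨0, ?_⟩
  have e : (finRotate (q + 1 + 1)).symm (Fin.succ 0) = 0 :=
    Fin.ext (by rw [finRotate_symm_val]; simp)
  rw [e, Fin.cons_zero]

theorem tailMap_mem_weightPart (q : ℕ) (x : Chain k (Trunc k d) (q + 1)) :
    tailMap k d q x ∈ weightPart k d (q + 1) q := by
  suffices h : (⊤ : Submodule k (Chain k (Trunc k d) (q + 1))) ≤
      (weightPart k d (q + 1) q).comap (tailMap k d q) from h trivial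
  rw [← (chainBasis k d (q + 1)).span_eq, Submodule.span_le]
  rintro _ ⟨u, rfl⟩
  rw [SetLike.mem_coe, Submodule.mem_comap, tailMap_chainBasis]
  split_ifs with h
  · rw [weightPart_eq_span]
    have h2 := h.2
    push Not at h2
    exact Submodule.subset_span ⟨_, (wordWeight_eq_iff (Fin.tail u)).mpr h2, rfl⟩
  · exact Submodule.zero_mem _

/-- The projection commutes with b and vanishes on row q + 2 in weight q + 1, so boundaries from
there have no component 1 ⊗ v. -/
theorem tailMap_bMap {q : ℕ} {x : Chain k (Trunc k d) (q + 2)}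
    (hx : x ∈ weightPart k d (q + 1) (q + 2)) :
    tailMap k d q (bMap k (Trunc k d) (q + 1) x) = 0 := by
  have hb : bMap k (Trunc k d) (q + 1) x ∈ weightPart k d (q + 1) (q + 1) :=
    altSum_mem_weightPart k d _ _ _ hx
  have h := bMap_nondeg k d (q + 1) x
  rw [nondeg_eq_zero k d (by omega) (by omega) hx, map_zero, nondeg_eq_consMap_tailMap k d hb] at h
  rw [← tailMap_consMap k d (tailMap_mem_weightPart k d q _), ← h, map_zero]

end Homotopy

/-! ### Exactness of the rows -/

section Rows

variable (k : Type*) [Field k] [CharZero k] (d : ℕ)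

/-- Since (1 - t) ∑_{j<i} t^j x = x - t^i x, averaging over 0 ≤ i ≤ q gives x - Nx/(q+1) = x. The
division needs characteristic zero. -/
theorem exists_sub_tMap_eq {w q : ℕ} {x : Chain k (Trunc k d) q} (hx : x ∈ weightPart k d w q)
    (hN : normMap k (Trunc k d) q x = 0) :
    ∃ y ∈ weightPart k d w q, y - tMap k (Trunc k d) q y = x := by
  set t := tMap k (Trunc k d) q with ht
  have hpow : ∀ j : ℕ, (t ^ j) x ∈ weightPart k d w q := by
    intro j
    induction j with
    | zero => exact hx
    | succ j ih =>
      rw [pow_succ' t j, Module.End.mul_apply]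
      exact tMap_mem_weightPart k d w q ih
  have hgeom : ∀ i : ℕ, (∑ j ∈ Finset.range i, (t ^ j) x) - t (∑ j ∈ Finset.range i, (t ^ j) x) =
      x - (t ^ i) x := by
    intro i
    rw [map_sum]
    have e : ∀ j : ℕ, t ((t ^ j) x) = (t ^ (j + 1)) x := fun j => by
      rw [pow_succ' t j, Module.End.mul_apply]
    simp only [e]
    rw [← Finset.sum_sub_distrib, Finset.sum_range_sub' fun j => (t ^ j) x]
    rfl
  refine ⟨((q + 1 : ℕ) : k)⁻¹ • ∑ i ∈ Finset.range (q + 1), ∑ j ∈ Finset.range i, (t ^ j) x,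
    Submodule.smul_mem _ _ (Submodule.sum_mem _ fun i _ => Submodule.sum_mem _ fun j _ => hpow j),
    ?_⟩
  have hN' : ∑ i ∈ Finset.range (q + 1), (t ^ i) x = 0 := by
    rw [← hN, normMap, LinearMap.sum_apply]
  rw [map_smul, ← smul_sub, map_sum, ← Finset.sum_sub_distrib, Finset.sum_congr rfl fun i _ => hgeom i,
    Finset.sum_sub_distrib, hN', sub_zero, Finset.sum_const, Finset.card_range,
    ← Nat.cast_smul_eq_nsmul k, smul_smul, inv_mul_cancel₀ (Nat.cast_ne_zero.mpr (by omega)),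
    one_smul]

theorem exists_normMap_eq {w q : ℕ} {x : Chain k (Trunc k d) q} (hx : x ∈ weightPart k d w q)
    (ht : x - tMap k (Trunc k d) q x = 0) :
    ∃ y ∈ weightPart k d w q, normMap k (Trunc k d) q y = x := by
  refine ⟨((q + 1 : ℕ) : k)⁻¹ • x, Submodule.smul_mem _ _ hx, ?_⟩
  have hpow : ∀ j : ℕ, (tMap k (Trunc k d) q ^ j) x = x := by
    intro j
    induction j with
    | zero => rfl
    | succ j ih => 
      rw [pow_succ (tMap k (Trunc k d) q) j, Module.End.mul_apply, ← sub_eq_zero.mp ht, ih]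
  rw [map_smul, normMap, LinearMap.sum_apply, Finset.sum_congr rfl fun i _ => hpow i,
    Finset.sum_const, Finset.card_range, ← Nat.cast_smul_eq_nsmul k, smul_smul,
    inv_mul_cancel₀ (Nat.cast_ne_zero.mpr (by omega)), one_smul]

end Rows

/-! ### Solving column by column -/

section Columns

variable (k : Type*) [CommRing k] (d : ℕ)

/-- The homotopies of the columns of the double complex. -/
def colHtpy (p : ℤ) (q : ℕ) : Chain k (Trunc k d) q →ₗ[k] Chain k (Trunc k d) (q + 1) :=
  if Even p then htpy k d q else -consMap k 1 q

/-- The defect of the homotopies of the columns. -/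
def colRes (p : ℤ) (q : ℕ) : Chain k (Trunc k d) q →ₗ[k] Chain k (Trunc k d) q :=
  if Even p then nondeg k d q else 0

theorem colHtpy_mem_weightPart (p : ℤ) {w q : ℕ} {x : Chain k (Trunc k d) q}
    (hx : x ∈ weightPart k d w q) : colHtpy k d p q x ∈ weightPart k d w (q + 1) := by
  rw [colHtpy]
  split_ifs
  · exact htpy_mem_weightPart k d hx
  · exact Submodule.neg_mem _ (consMap_one_mem_weightPart k d hx)

theorem vert_colHtpy_succ (p : ℤ) (q : ℕ) (x : Chain k (Trunc k d) (q + 1)) :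
    vert k (Trunc k d) p (q + 1) (colHtpy k d p (q + 1) x) +
      colHtpy k d p q (vert k (Trunc k d) p q x) = x - colRes k d p (q + 1) x := by
  by_cases hp : Even p
  · simp only [vert, colHtpy, colRes, if_pos hp, bMap_htpy_succ]
  · simp only [vert, colHtpy, colRes, if_neg hp, LinearMap.neg_apply, map_neg, neg_neg,
      bMap'_consMap_one, LinearMap.zero_apply, sub_zero]

theorem vert_colHtpy_zero (p : ℤ) (x : Chain k (Trunc k d) 0) :
    vert k (Trunc k d) p 0 (colHtpy k d p 0 x) = x - colRes k d p 0 x := by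
  by_cases hp : Even p
  · simp only [vert, colHtpy, colRes, if_pos hp, bMap_htpy_zero]
  · simp only [vert, colHtpy, colRes, if_neg hp, LinearMap.neg_apply, map_neg, neg_neg,
      bMap'_consMap_one_zero, LinearMap.zero_apply, sub_zero]

theorem colRes_of_odd {p : ℤ} (hp : ¬ Even p) (q : ℕ) (x : Chain k (Trunc k d) q) :
    colRes k d p q x = 0 := by simp [colRes, hp]

theorem colRes_eq_zero (p : ℤ) {w q : ℕ} (h1 : q ≠ w) (h2 : q + 1 ≠ w)
    {x : Chain k (Trunc k d) q} (hx : x ∈ weightPart k d w q) : colRes k d p q x = 0 := by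
  rw [colRes]
  split_ifs
  · exact nondeg_eq_zero k d h1 h2 hx
  · rfl

theorem totalD_succ_apply {A : Type*} [Ring A] [Algebra k A] (n : ℤ) (x : ∀ q : ℕ, Chain k A q)
    (q : ℕ) : totalD k A (n + 1) x q =
      vert k A (n - q) q (x (q + 1)) + horiz k A (n + 1 - q) q (x q) := by
  have e : n + 1 - 1 - (q : ℤ) = n - q := by ring
  simp only [totalD, LinearMap.pi_apply, LinearMap.add_apply, LinearMap.comp_apply,
    LinearMap.proj_apply, e]

theorem totalD_apply {A : Type*} [Ring A] [Algebra k A] (n : ℤ) (x : ∀ q : ℕ, Chain k A q)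
    (q : ℕ) : totalD k A n x q =
      vert k A (n - 1 - q) q (x (q + 1)) + horiz k A (n - q) q (x q) := rfl

/-- The family which agrees with `y` in rows up to `q₁` and solves `D z = x` above. -/
def extend (n : ℤ) (q₁ : ℕ) (x y : ∀ q : ℕ, Chain k (Trunc k d) q) :
    ∀ q : ℕ, Chain k (Trunc k d) q
  | 0 => y 0
  | q + 1 => if q + 1 ≤ q₁ then y (q + 1) else
      colHtpy k d (n - q) q (x q - horiz k (Trunc k d) (n + 1 - q) q (extend n q₁ x y q))

theorem extend_of_le (n : ℤ) {q₁ q : ℕ} (hq : q ≤ q₁) (x y : ∀ q : ℕ, Chain k (Trunc k d) q) :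
    extend k d n q₁ x y q = y q := by
  cases q with
  | zero => rfl
  | succ q => rw [extend, if_pos hq]

theorem extend_mem (n : ℤ) (q₁ w : ℕ) {x y : ∀ q : ℕ, Chain k (Trunc k d) q}
    (hx : ∀ q, x q ∈ weightPart k d w q) (hy : ∀ q, y q ∈ weightPart k d w q) (q : ℕ) :
    extend k d n q₁ x y q ∈ weightPart k d w q := by
  induction q with
  | zero => exact hy 0
  | succ q ih =>
    rw [extend]
    split_ifs
    · exact hy _
    · exact colHtpy_mem_weightPart k d _
        (Submodule.sub_mem _ (hx q) (horiz_mem_weightPart k d w _ q ih))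

/-- A partial solution of `D y = x` extends to all higher rows if the columns there are exact. -/
theorem exists_extension (w : ℕ) (n : ℤ) (q₁ : ℕ) (hn : n ≤ q₁)
    {x y : ∀ q : ℕ, Chain k (Trunc k d) q} (hx : totalD k (Trunc k d) n x = 0)
    (hxS : ∀ q, x q ∈ weightPart k d w q)
    (hy : y ∈ negTotIn k (Trunc k d) (weightPart k d w) (n + 1))
    (h0 : ∀ q < q₁, totalD k (Trunc k d) (n + 1) y q = x q)
    (h1 : colRes k d (n - q₁) q₁ (x q₁ - horiz k (Trunc k d) (n + 1 - q₁) q₁ (y q₁)) = 0)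
    (h2 : ∀ q > q₁, ∀ z ∈ weightPart k d w q, colRes k d (n - q) q z = 0) :
    ∃ z ∈ negTotIn k (Trunc k d) (weightPart k d w) (n + 1),
      totalD k (Trunc k d) (n + 1) z = x ∧ ∀ q ≤ q₁, z q = y q := by
  set z := extend k d n q₁ x y with hz
  have hzS := extend_mem k d n q₁ w hxS (fun q => hy.2 q trivial)
  refine ⟨z, ⟨fun q hq => ?_, fun q _ => hzS q⟩, funext fun q => ?_,
    fun q hq => extend_of_le k d n hq x y⟩
  -- Rows forced to vanish in degree n + 1 satisfy q ≤ n ≤ q₁, so there the family still agrees with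
  -- y.
  · rw [hz, extend_of_le k d n (by omega)]
    exact hy.1 q hq
  have hlt : ∀ q < q₁, totalD k (Trunc k d) (n + 1) z q = x q := by
    intro q hq
    rw [← h0 q hq, totalD_succ_apply, totalD_succ_apply, hz, extend_of_le k d n (by omega),
      extend_of_le k d n (by omega)]
  have hres : ∀ q, q₁ ≤ q →
      colRes k d (n - q) q (x q - horiz k (Trunc k d) (n + 1 - q) q (z q)) = 0 := by
    intro q hq
    rcases eq_or_lt_of_le hq with rfl | hq
    · rw [hz, extend_of_le k d n le_rfl]; exact h1
    · exact h2 q hq _ (Submodule.sub_mem _ (hxS q) (horiz_mem_weightPart k d w _ q (hzS q)))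
  have hsucc : ∀ q, q₁ ≤ q → z (q + 1) =
      colHtpy k d (n - q) q (x q - horiz k (Trunc k d) (n + 1 - q) q (z q)) := by
    intro q hq
    rw [hz, extend, if_neg (by omega)]
  induction q with
  | zero =>
    rcases Nat.eq_zero_or_pos q₁ with rfl | hq
    · rw [totalD_succ_apply, hsucc 0 le_rfl, vert_colHtpy_zero, hres 0 le_rfl, sub_zero,
        sub_add_cancel]
    · exact hlt 0 hq
  | succ q ih =>
    rcases lt_or_ge (q + 1) q₁ with hq | hq
    · exact hlt _ hq
    -- x - D z is a cycle which vanishes in row q by induction, so its entry in row q + 1 is a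
    -- vertical cycle. As vertical maps compose to zero, so is x_{q+1} minus the horizontal image of
    -- z_{q+1}, and the homotopy lifts it.
    · have hD : totalD k (Trunc k d) n (x - totalD k (Trunc k d) (n + 1) z) q = 0 := by
        have := LinearMap.congr_fun (totalD_comp_totalD k (Trunc k d) n) z
        rw [LinearMap.comp_apply] at this
        rw [map_sub, hx, this]; simp
      have e : n - 1 - (q : ℤ) = n - (q + 1 : ℕ) := by push_cast; ring
      rw [totalD_apply, Pi.sub_apply, Pi.sub_apply, ih, sub_self, map_zero, add_zero,
        totalD_succ_apply, e, add_comm (vert _ _ _ _ _), ← sub_sub, map_sub] at hD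
      have hvv := LinearMap.congr_fun (vert_comp_vert k (Trunc k d) (n - (q + 1 : ℕ)) q)
        (z (q + 1 + 1))
      rw [LinearMap.comp_apply, LinearMap.zero_apply] at hvv
      rw [hvv, sub_zero] at hD
      have h := vert_colHtpy_succ k d (n - (q + 1 : ℕ)) q
        (x (q + 1) - horiz k (Trunc k d) (n + 1 - (q + 1 : ℕ)) (q + 1) (z (q + 1)))
      rw [hD, map_zero, add_zero, hres (q + 1) hq, sub_zero, ← hsucc (q + 1) hq] at h
      rw [totalD_succ_apply, h, sub_add_cancel]

theorem subsingleton_HCNegWeight (w : ℕ) (n : ℤ)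
    (h : ∀ x ∈ negCycles k (Trunc k d) (weightPart k d w) n,
      ∃ y ∈ negTotIn k (Trunc k d) (weightPart k d w) (n + 1),
        totalD k (Trunc k d) (n + 1) y = x) : Subsingleton (HCNegWeight k d w n) := by
  rw [Submodule.Quotient.subsingleton_iff, eq_top_iff]
  rintro ⟨x, hx⟩ -
  exact h x hx

/-- The homology is the target of a surjection from the cycles with the boundaries as kernel. -/
theorem nonempty_HCNegWeight_equiv (w : ℕ) (n : ℤ) {M : Type*} [AddCommGroup M] [Module k M]
    (f : negCycles k (Trunc k d) (weightPart k d w) n →ₗ[k] M) (hf : Function.Surjective f)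
    (h1 : ∀ x : negCycles k (Trunc k d) (weightPart k d w) n, f x = 0 → ∃ y ∈ negTotIn k (Trunc k d) (weightPart k d w) (n + 1),
      totalD k (Trunc k d) (n + 1) y = x)
    (h2 : ∀ x : negCycles k (Trunc k d) (weightPart k d w) n, (∃ y ∈ negTotIn k (Trunc k d) (weightPart k d w) (n + 1),
      totalD k (Trunc k d) (n + 1) y = x) → f x = 0) :
    Nonempty (HCNegWeight k d w n ≃ₗ[k] M) := by
  have e : (negBoundaries k (Trunc k d) (weightPart k d w) n).submoduleOf
      (negCycles k (Trunc k d) (weightPart k d w) n) = LinearMap.ker f :=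
    Submodule.ext fun x => ⟨fun hx => h2 x hx, fun hx => h1 x hx⟩
  exact ⟨(Submodule.quotEquivOfEq _ _ e).trans (f.quotKerEquivOfSurjective hf)⟩

end Columns

/-! ### The homology in weight zero -/

section WeightZero

variable (k : Type*) [CommRing k] (d : ℕ)

theorem bMap_zero_eq_zero : bMap k (Trunc k d) 0 = 0 := by
  apply PiTensorProduct.ext
  ext a
  simp only [LinearMap.compMultilinearMap_apply, bMap, Finset.sum_range_succ, Finset.sum_range_zero,
    zero_add, pow_zero, pow_one, one_smul, LinearMap.add_apply, LinearMap.smul_apply, face_tprod,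
    neg_smul, LinearMap.zero_apply]
  rw [← sub_eq_add_neg, sub_eq_zero]
  congr 1
  funext j
  obtain rfl : j = 0 := Fin.ext (by omega)
  simpa [faceFun] using mul_comm _ _

theorem tMap_zero_eq_one : tMap k (Trunc k d) 0 = 1 := by
  simpa using tMap_pow k (Trunc k d) 0

theorem zero_mem_negTotIn (w : ℕ) (n : ℤ) :
    (0 : ∀ q : ℕ, Chain k (Trunc k d) q) ∈ negTotIn k (Trunc k d) (weightPart k d w) n :=
  Submodule.zero_mem _

theorem subsingleton_HCNegWeight_zero {n : ℤ} (hn : ¬ (Even n ∧ n ≤ 0)) :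
    Subsingleton (HCNegWeight k d 0 n) := by
  refine subsingleton_HCNegWeight k d 0 n fun x hx => ?_
  obtain ⟨z, hz, hzx, -⟩ := exists_extension k d 0 n n.toNat (by omega) hx.1
    (fun q => hx.2.2 q trivial) (zero_mem_negTotIn k d 0 (n + 1))
    (fun q hq => by rw [map_zero, hx.2.1 q (by omega)]; rfl)
    (by
      rw [Pi.zero_apply, map_zero, sub_zero]
      -- If n ≤ 0 the first row to solve is row 0, in the column n, which is then odd. If n > 0 it
      -- is row n, where nothing of weight zero survives.
      rcases Nat.eq_zero_or_pos n.toNat with h | h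
      · refine colRes_of_odd k d ?_ _ _
        rw [h, Nat.cast_zero, sub_zero]
        exact fun he => hn ⟨he, by omega⟩
      · exact colRes_eq_zero k d _ (by omega) (by omega) (hx.2.2 _ trivial))
    (fun q hq z hz => colRes_eq_zero k d _ (by omega) (by omega) hz)
  exact ⟨z, hz, hzx⟩

/-- The unit word spans the weight zero part of `A`. -/
theorem weightPart_zero_zero :
    weightPart k d 0 0 = Submodule.span k {chainBasis k d 0 fun _ => none} := by
  rw [weightPart_eq_span]
  congr 1
  ext x
  simp only [Set.mem_image, Set.mem_singleton_iff]
  have h : ∀ u : Fin 1 → Option (Fin d), wordWeight u = 0 ↔ u = fun _ => none := by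
    intro u
    have e : wordWeight u = letterWeight (u 0) := Fin.sum_univ_one _
    rw [e]
    constructor
    · intro h
      funext i
      obtain rfl : i = 0 := Subsingleton.elim _ _
      by_contra h0
      rw [letterWeight_eq_one.mpr h0] at h
      exact one_ne_zero h
    · rintro rfl; rfl
  constructor
  · rintro ⟨u, hu, rfl⟩
    rw [(h u).mp hu]
  · rintro rfl
    exact ⟨_, (h _).mpr rfl, rfl⟩

theorem nonempty_HCNegWeight_zero_equiv {n : ℤ} (hn : Even n) (hn0 : n ≤ 0) :
    Nonempty (HCNegWeight k d 0 n ≃ₗ[k] k) := by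
  set u : Fin 1 → Option (Fin d) := fun _ => none
  set φ := (chainBasis k d 0).coord u with hφ
  have hφ0 : ∀ x ∈ weightPart k d 0 0, φ x = 0 → x = 0 := by
    intro x hx h
    rw [weightPart_zero_zero] at hx
    obtain ⟨c, rfl⟩ := Submodule.mem_span_singleton.mp hx
    rw [map_smul, hφ, Module.Basis.coord_apply, Module.Basis.repr_self, Finsupp.single_eq_same,
      smul_eq_mul, mul_one] at h
    rw [h, zero_smul]
  have hodd : ¬ Even (n + 1) := by rwa [Int.even_add_one, not_not]
  refine nonempty_HCNegWeight_equiv k d 0 n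
    (φ ∘ₗ LinearMap.proj 0 ∘ₗ (negCycles k (Trunc k d) (weightPart k d 0) n).subtype) ?_ ?_ ?_
  · intro c
    -- A cycle solves D z = 0, so the extension is applied one degree lower, starting from c·1 in
    -- row 0. The first residue lies in the odd column m and is zero.
    obtain ⟨m, rfl⟩ : ∃ m, n = m + 1 := ⟨n - 1, by ring⟩
    have hm : ¬ Even m := by rwa [Int.even_add_one] at hn
    have hu : c • chainBasis k d 0 u ∈ weightPart k d 0 0 := by
      rw [weightPart_zero_zero]
      exact Submodule.smul_mem _ _ (Submodule.mem_span_singleton_self _)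
    obtain ⟨z, hz, hz0, hz1⟩ := exists_extension k d 0 m 0 (by simp; omega)
      (x := 0) (y := Pi.single 0 (c • chainBasis k d 0 u)) (map_zero _)
      (fun q => Submodule.zero_mem _)
      ⟨fun q hq => by omega, fun q _ => by
        rcases Nat.eq_zero_or_pos q with rfl | hq
        · rwa [Pi.single_eq_same]
        · rw [Pi.single_eq_of_ne (by omega)]; exact Submodule.zero_mem _⟩
      (fun q hq => by omega) (colRes_of_odd k d (by simpa using hm) _ _)
      (fun q hq z hz => colRes_eq_zero k d _ (by omega) (by omega) hz)
    refine ⟨⟨z, hz0, hz⟩, ?_⟩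
    simp only [LinearMap.comp_apply, Submodule.subtype_apply, LinearMap.proj_apply]
    rw [hz1 0 le_rfl, Pi.single_eq_same, map_smul, hφ, Module.Basis.coord_apply,
      Module.Basis.repr_self, Finsupp.single_eq_same, smul_eq_mul, mul_one]
  · rintro ⟨x, hx⟩ hx0
    have h := hφ0 (x 0) (hx.2.2 0 trivial) hx0
    obtain ⟨z, hz, hzx, -⟩ := exists_extension k d 0 n 0 (by simpa using hn0) hx.1
      (fun q => hx.2.2 q trivial) (zero_mem_negTotIn k d 0 (n + 1))
      (fun q hq => by omega) (by rw [Pi.zero_apply, map_zero, sub_zero, h, map_zero])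
      (fun q hq z hz => colRes_eq_zero k d _ (by omega) (by omega) hz)
    exact ⟨z, hz, hzx⟩
  · rintro ⟨x, hx⟩ ⟨y, hy, hyx⟩
    change φ (x 0) = 0
    -- Boundaries vanish in row 0: b is zero there by commutativity, and 1 - t because t = 1.
    have h : x 0 = 0 := by
      have h0 : totalD k (Trunc k d) (n + 1) y 0 = x 0 := congrFun hyx 0
      rw [← h0, totalD_succ_apply, Nat.cast_zero, sub_zero, sub_zero, vert, if_pos hn,
        bMap_zero_eq_zero, horiz, if_neg hodd, tMap_zero_eq_one, sub_self, LinearMap.zero_apply,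
        LinearMap.zero_apply, add_zero]
    rw [h, map_zero]

end WeightZero

/-! ### The homology in positive weight -/

section PositiveWeight

variable (k : Type*) [CommRing k] (d : ℕ)

/-- The invariants of the signed rotation on the words of length `r + 1` without units. -/
def cyclicInvariants (r : ℕ) : Submodule k (Chain k (Trunc k d) r) :=
  LinearMap.ker (1 - tMap k (Trunc k d) r) ⊓ weightPart k d (r + 1) r

theorem eq_zero_of_mem_weightPart {w q : ℕ} (h : q + 1 < w) {x : Chain k (Trunc k d) q}
    (hx : x ∈ weightPart k d w q) : x = 0 := by
  rwa [weightPart_eq_bot k d h, Submodule.mem_bot] at hx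

/-- Row r is the lowest one with weight r + 1, so b'v = 0 and the contraction formula loses its
second term. -/
theorem bMap'_consMap_of_mem {r : ℕ} {v : Chain k (Trunc k d) r}
    (hv : v ∈ weightPart k d (r + 1) r) :
    bMap' k (Trunc k d) r (consMap k 1 r v) = v := by
  cases r with
  | zero => exact bMap'_consMap_one_zero k _ v
  | succ r =>
    have h : bMap' k (Trunc k d) r v = 0 :=
      eq_zero_of_mem_weightPart k d (by omega) (altSum_mem_weightPart k d _ r _ hv)
    have := bMap'_consMap_one k (Trunc k d) r v
    rwa [h, map_zero, add_zero] at this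

theorem bMap_consMap_of_mem {r : ℕ} {v : Chain k (Trunc k d) r}
    (hv : v ∈ weightPart k d (r + 1) r) :
    bMap k (Trunc k d) r (consMap k 1 r v) = v - tMap k (Trunc k d) r v := by
  rw [bMap_consMap_one, bMap'_consMap_of_mem k d hv]

/-- In the target every word is free of units, so the projection is the identity there; hence x may
be replaced by its projection 1 ⊗ `tailMap` x before applying b. -/
theorem sub_tMap_tailMap {r : ℕ} {x : Chain k (Trunc k d) (r + 1)}
    (hx : x ∈ weightPart k d (r + 1) (r + 1)) :
    tailMap k d r x - tMap k (Trunc k d) r (tailMap k d r x) = bMap k (Trunc k d) r x := by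
  have hb : bMap k (Trunc k d) r x ∈ weightPart k d (r + 1) r :=
    altSum_mem_weightPart k d _ _ _ hx
  rw [← bMap_consMap_of_mem k d (tailMap_mem_weightPart k d r x),
    ← nondeg_eq_consMap_tailMap k d hx, bMap_nondeg,
    nondeg_eq_self k d hb]

/-- Write x = b'(1 ⊗ x) + 1 ⊗ b'x. On the first term (1 - t)b' = b(1 - t), which `tailMap` kills; on
the second the rotated part is killed and b'x remains. -/
theorem tailMap_sub_tMap {r : ℕ} {x : Chain k (Trunc k d) (r + 1)}
    (hx : x ∈ weightPart k d (r + 1) (r + 1)) :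
    tailMap k d r (x - tMap k (Trunc k d) (r + 1) x) = bMap' k (Trunc k d) r x := by
  have hs := bMap'_consMap_one k (Trunc k d) r x
  set u := consMap k 1 (r + 1) x with hu
  have huS : u ∈ weightPart k d (r + 1) (r + 2) := consMap_one_mem_weightPart k d hx
  have h1 := LinearMap.congr_fun (one_sub_tMap_comp_bMap' k (Trunc k d) (r + 1)) u
  simp only [LinearMap.comp_apply, LinearMap.sub_apply, Module.End.one_apply] at h1
  have h2 := tailMap_bMap k d
    (Submodule.sub_mem _ huS (tMap_mem_weightPart k d _ _ huS))
  rw [← h1] at h2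
  have h3 : bMap' k (Trunc k d) r x ∈ weightPart k d (r + 1) r := altSum_mem_weightPart k d _ _ _ hx
  conv_lhs => rw [← hs]
  rw [map_add, add_sub_add_comm, map_add, h2, zero_add, map_sub, tailMap_tMap_consMap, sub_zero,
    tailMap_consMap k d h3]

theorem subsingleton_HCNegWeight_of_lt {r : ℕ} {n : ℤ} (hn : ((r + 1 : ℕ) : ℤ) < n) :
    Subsingleton (HCNegWeight k d (r + 1) n) := by
  refine subsingleton_HCNegWeight k d _ n fun x hx => ?_
  obtain ⟨z, hz, hzx, -⟩ := exists_extension k d (r + 1) n n.toNat (by omega) hx.1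
    (fun q => hx.2.2 q trivial) (zero_mem_negTotIn k d _ (n + 1))
    (fun q hq => by rw [map_zero, hx.2.1 q (by omega)]; rfl)
    (by
      rw [Pi.zero_apply, map_zero, sub_zero]
      exact colRes_eq_zero k d _ (by omega) (by omega) (hx.2.2 _ trivial))
    (fun q hq z hz => colRes_eq_zero k d _ (by omega) (by omega) hz)
  exact ⟨z, hz, hzx⟩

theorem single_mem_weightPart {w q : ℕ} {v : Chain k (Trunc k d) q} (hv : v ∈ weightPart k d w q)
    (j : ℕ) : (Pi.single q v : ∀ q : ℕ, Chain k (Trunc k d) q) j ∈ weightPart k d w j := by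
  rcases eq_or_ne j q with rfl | h
  · rwa [Pi.single_eq_same]
  · rw [Pi.single_eq_of_ne h]; exact Submodule.zero_mem _

theorem single_mem_negTotIn {w q : ℕ} {v : Chain k (Trunc k d) q} (hv : v ∈ weightPart k d w q)
    {n : ℤ} (hn : n ≤ q) :
    (Pi.single q v : ∀ q : ℕ, Chain k (Trunc k d) q) ∈
      negTotIn k (Trunc k d) (weightPart k d w) n :=
  ⟨fun j hj => Pi.single_eq_of_ne (by rintro rfl; omega) _,
    fun j _ => single_mem_weightPart k d hv j⟩

/-- In degree r + 1 the row r + 1 lies in column 0, and all lower rows vanish. So the cycle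
condition on the surviving part is only (1 - t)v = 0, and no norm arrives from column 1. -/
theorem nonempty_HCNegWeight_equiv_cyclicInvariants (r : ℕ) :
    Nonempty (HCNegWeight k d (r + 1) ((r + 1 : ℕ) : ℤ) ≃ₗ[k] cyclicInvariants k d r) := by
  have hcast : ((r + 1 : ℕ) : ℤ) = (r : ℤ) + 1 := by push_cast; ring
  rw [hcast]
  have hz1 : (r : ℤ) + 1 - (r + 1 : ℕ) = 0 := by push_cast; ring
  have hz2 : (r : ℤ) - r = 0 := sub_self _
  have hmem : ∀ x ∈ negCycles k (Trunc k d) (weightPart k d (r + 1)) ((r : ℤ) + 1),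
      tailMap k d r (x (r + 1)) ∈ cyclicInvariants k d r := by
    intro x hx
    refine ⟨?_, tailMap_mem_weightPart k d r _⟩
    have h0 : x r = 0 := hx.2.1 r (by omega)
    have h := congrFun hx.1 r
    rw [totalD_succ_apply, h0, map_zero, add_zero, hz2, vert, if_pos Even.zero] at h
    rw [SetLike.mem_coe, LinearMap.mem_ker, LinearMap.sub_apply, Module.End.one_apply,
      sub_tMap_tailMap k d (hx.2.2 (r + 1) trivial)]
    exact h
  refine nonempty_HCNegWeight_equiv k d (r + 1) ((r : ℤ) + 1)
    ((tailMap k d r ∘ₗ LinearMap.proj (r + 1) ∘ₗ Submodule.subtype _).codRestrict _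
      fun x => hmem x x.2) ?_ ?_ ?_
  · rintro ⟨v, hv, hvS⟩
    have hsS := consMap_one_mem_weightPart k d hvS
    have hy := single_mem_negTotIn k d hsS (n := (r : ℤ) + 1) (by push_cast; omega)
    -- The next equation lies in column -1, which is exact, so 1 ⊗ v extends to a cycle.
    have hodd : ¬ Even ((r : ℤ) - (r + 1 : ℕ)) := by
      have e : (r : ℤ) - (r + 1 : ℕ) = -1 := by push_cast; ring
      rw [e]; decide
    obtain ⟨z, hz, hz0, hz1⟩ := exists_extension k d (r + 1) r (r + 1) (by push_cast; omega)
      (x := 0) (y := Pi.single (r + 1) (consMap k 1 r v)) (map_zero _)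
      (fun q => Submodule.zero_mem _) hy
      (fun q hq => by
        rcases eq_or_ne q r with rfl | hqr
        · rw [totalD_succ_apply, Pi.single_eq_same, Pi.single_eq_of_ne (by omega), map_zero,
            add_zero, hz2, vert, if_pos Even.zero, bMap_consMap_of_mem k d hvS]
          exact hv
        · exact eq_zero_of_mem_weightPart k d (by omega)
            ((totalD_mem_negTotIn k d _ _ hy).2 q trivial))
      (colRes_of_odd k d hodd _ _)
      (fun q hq z hz => colRes_eq_zero k d _ (by omega) (by omega) hz)
    refine ⟨⟨z, hz0, hz⟩, Subtype.ext ?_⟩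
    change tailMap k d r (z (r + 1)) = v
    rw [hz1 _ le_rfl, Pi.single_eq_same, tailMap_consMap k d hvS]
  · rintro ⟨x, hx⟩ hx0
    have h0 : tailMap k d r (x (r + 1)) = 0 := congrArg Subtype.val hx0
    obtain ⟨z, hz, hzx, -⟩ := exists_extension k d (r + 1) ((r : ℤ) + 1) (r + 1)
      (by push_cast; omega) hx.1 (fun q => hx.2.2 q trivial) (zero_mem_negTotIn k d _ _)
      (fun q hq => by rw [map_zero, hx.2.1 q (by omega)]; rfl)
      (by
        rw [Pi.zero_apply, map_zero, sub_zero, colRes]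
        split_ifs
        · rw [nondeg_eq_consMap_tailMap k d (hx.2.2 _ trivial), h0, map_zero]
        · rfl)
      (fun q hq z hz => colRes_eq_zero k d _ (by omega) (by omega) hz)
    exact ⟨z, hz, hzx⟩
  · rintro ⟨x, hx⟩ ⟨y, hy, hyx⟩
    refine Subtype.ext ?_
    change tailMap k d r (x (r + 1)) = 0
    have h0 : totalD k (Trunc k d) ((r : ℤ) + 1 + 1) y (r + 1) = x (r + 1) := congrFun hyx (r + 1)
    -- The bounding family has no entry in column 1, so x_{r+1} is a vertical boundary.
    rw [← h0, totalD_succ_apply, hy.1 (r + 1) (by push_cast; omega), map_zero, add_zero, hz1, vert,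
      if_pos Even.zero, tailMap_bMap k d (hy.2 _ trivial)]

end PositiveWeight

/-! ### Vanishing in the degrees n ≠ w -/

section Vanishing

variable (k : Type*) [Field k] [CharZero k] (d : ℕ)

/-- Here x_{r+1} is in an even column, and row r of D x = 0 says that `tailMap` x_{r+1} + x_r is
invariant, hence a norm N y. -/
theorem subsingleton_HCNegWeight_of_even_sub {r : ℕ} {n : ℤ} (hn : n ≤ r)
    (he : Even (n - (r + 1 : ℕ))) : Subsingleton (HCNegWeight k d (r + 1) n) := by
  refine subsingleton_HCNegWeight k d _ n fun x hx => ?_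
  have hxS : ∀ q, x q ∈ weightPart k d (r + 1) q := fun q => hx.2.2 q trivial
  -- Parity improves n < r + 1 by one, so row r of a family of degree n + 1 lies in a column p ≤ 0
  -- and may hold y.
  have hnr : n + 2 ≤ (r + 1 : ℕ) := by
    obtain ⟨m, hm⟩ := he
    push_cast at hm ⊢
    omega
  have e1 : n - 1 - (r : ℤ) = n - (r + 1 : ℕ) := by push_cast; ring
  have ho1 : ¬ Even (n - (r : ℤ)) := by
    have e : n - (r : ℤ) = n - (r + 1 : ℕ) + 1 := by push_cast; ring
    rwa [e, Int.even_add_one, not_not]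
  have ho2 : ¬ Even (n + 1 - ((r + 1 : ℕ) : ℤ)) := by
    have e : n + 1 - ((r + 1 : ℕ) : ℤ) = n - (r + 1 : ℕ) + 1 := by ring
    rwa [e, Int.even_add_one, not_not]
  have he2 : Even (n + 1 - (r : ℤ)) := by
    have e : n + 1 - (r : ℤ) = n - (r + 1 : ℕ) + 1 + 1 := by push_cast; ring
    rwa [e, Int.even_add_one, Int.even_add_one, not_not]
  have hxr := congrFun hx.1 r
  rw [totalD_apply, e1, vert, if_pos he, horiz, if_neg ho1, LinearMap.sub_apply,
    Module.End.one_apply, ← sub_tMap_tailMap k d (hxS (r + 1))] at hxr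
  obtain ⟨y, hyS, hy⟩ := exists_normMap_eq k d
    (x := tailMap k d r (x (r + 1)) + x r)
    (Submodule.add_mem _ (tailMap_mem_weightPart k d r _) (hxS r))
    (by rw [map_add, add_sub_add_comm]; exact hxr)
  have hvS : x r - normMap k (Trunc k d) r y ∈ weightPart k d (r + 1) r := by
    rw [hy, sub_add_cancel_right]
    exact Submodule.neg_mem _ (tailMap_mem_weightPart k d r _)
  have hsS := consMap_one_mem_weightPart k d hvS
  -- With v = x_r - N y, the pair (y, -(1 ⊗ v)) solves row r because b'(1 ⊗ v) = v. It also removes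
  -- the residue in row r + 1 because v = -`tailMap` x_{r+1}.
  have hy₀ := Submodule.sub_mem _
    (single_mem_negTotIn k d hyS (n := n + 1) (by push_cast at hnr; omega))
    (single_mem_negTotIn k d hsS (n := n + 1) (by omega))
  obtain ⟨z, hz, hzx, -⟩ := exists_extension k d (r + 1) n (r + 1) (by omega) hx.1 hxS hy₀
    (fun q hq => by
      rcases eq_or_ne q r with rfl | hqr
      · rw [totalD_succ_apply, Pi.sub_apply, Pi.sub_apply, Pi.single_eq_same, Pi.single_eq_same,
          Pi.single_eq_of_ne (by omega), Pi.single_eq_of_ne (by omega), zero_sub, sub_zero, vert,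
          if_neg ho1, horiz, if_pos he2, LinearMap.neg_apply, map_neg, neg_neg,
          bMap'_consMap_of_mem k d hvS, sub_add_cancel]
      · rw [eq_zero_of_mem_weightPart k d (by omega) (hxS q)]
        exact eq_zero_of_mem_weightPart k d (by omega)
          ((totalD_mem_negTotIn k d _ _ hy₀).2 q trivial))
    (by
      rw [Pi.sub_apply, Pi.single_eq_same, Pi.single_eq_of_ne (by omega), zero_sub, map_neg,
        sub_neg_eq_add, colRes, if_pos he, horiz, if_neg ho2, LinearMap.sub_apply,
        Module.End.one_apply, nondeg_eq_consMap_tailMap k d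
          (Submodule.add_mem _ (hxS _) (Submodule.sub_mem _ hsS (tMap_mem_weightPart k d _ _ hsS))),
        map_add, map_sub, tailMap_tMap_consMap,
        sub_zero, tailMap_consMap k d hvS, hy, sub_add_cancel_right, add_neg_cancel, map_zero])
    (fun q hq z hz => colRes_eq_zero k d _ (by omega) (by omega) hz)
  exact ⟨z, hz, hzx⟩

/-- Now x_r is in an even column. Once N x_r = 0 is known, x_r = y - ty = b(1 ⊗ y) solves row r, and
the next column is odd. -/
theorem subsingleton_HCNegWeight_of_odd_sub {r : ℕ} {n : ℤ} (hn : n ≤ r)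
    (he : Even (n - r)) : Subsingleton (HCNegWeight k d (r + 1) n) := by
  refine subsingleton_HCNegWeight k d _ n fun x hx => ?_
  have hxS : ∀ q, x q ∈ weightPart k d (r + 1) q := fun q => hx.2.2 q trivial
  have ho : ¬ Even (n - (r + 1 : ℕ)) := by
    have e : n - (r : ℤ) = n - (r + 1 : ℕ) + 1 := by push_cast; ring
    rwa [e, Int.even_add_one] at he
  have e1 : n - 1 - (r : ℤ) = n - (r + 1 : ℕ) := by push_cast; ring
  have he1 : Even (n - 1 - ((r + 1 : ℕ) : ℤ)) := by
    have e : n - (r : ℤ) = n - 1 - (r + 1 : ℕ) + 1 + 1 := by push_cast; ring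
    rwa [e, Int.even_add_one, Int.even_add_one, not_not] at he
  have hxr := congrFun hx.1 r
  rw [totalD_apply, e1, vert, if_neg ho, horiz, if_pos he] at hxr
  have hxr1 := congrFun hx.1 (r + 1)
  rw [totalD_apply, vert, if_pos he1, horiz, if_neg ho, LinearMap.sub_apply,
    Module.End.one_apply] at hxr1
  -- Applying `tailMap` to row r + 1 of D x = 0 kills the boundary of x_{r+2} and turns (1 -
  -- t)x_{r+1} into b'x_{r+1}.
  have hb : bMap' k (Trunc k d) r (x (r + 1)) = 0 := by
    have h := congrArg (tailMap k d r) hxr1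
    rwa [map_add, tailMap_bMap k d (hxS (r + 2)), zero_add, tailMap_sub_tMap k d (hxS (r + 1)),
      Pi.zero_apply, map_zero] at h
  rw [LinearMap.neg_apply, hb, neg_zero, zero_add] at hxr
  obtain ⟨y, hyS, hy⟩ := exists_sub_tMap_eq k d (hxS r) hxr
  have hy₀ := single_mem_negTotIn k d (consMap_one_mem_weightPart k d hyS) (n := n + 1)
    (by push_cast; omega)
  obtain ⟨z, hz, hzx, -⟩ := exists_extension k d (r + 1) n (r + 1) (by push_cast; omega)
    hx.1 hxS hy₀
    (fun q hq => by
      rcases eq_or_ne q r with rfl | hqr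
      · rw [totalD_succ_apply, Pi.single_eq_same, Pi.single_eq_of_ne (by omega), map_zero,
          add_zero, vert, if_pos he, bMap_consMap_of_mem k d hyS, hy]
      · rw [eq_zero_of_mem_weightPart k d (by omega) (hxS q)]
        exact eq_zero_of_mem_weightPart k d (by omega)
          ((totalD_mem_negTotIn k d _ _ hy₀).2 q trivial))
    (colRes_of_odd k d ho _ _)
    (fun q hq z hz => colRes_eq_zero k d _ (by omega) (by omega) hz)
  exact ⟨z, hz, hzx⟩

theorem subsingleton_HCNegWeight_of_ne {w : ℕ} (hw : 0 < w) {n : ℤ} (hn : n ≠ w) :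
    Subsingleton (HCNegWeight k d w n) := by
  obtain ⟨r, rfl⟩ : ∃ r, w = r + 1 := ⟨w - 1, by omega⟩
  rcases lt_or_gt_of_ne hn with h | h
  · have hr : n ≤ r := by push_cast at h; omega
    by_cases he : Even (n - r)
    · exact subsingleton_HCNegWeight_of_odd_sub k d hr he
    · refine subsingleton_HCNegWeight_of_even_sub k d hr ?_
      have e : n - (r : ℤ) = n - (r + 1 : ℕ) + 1 := by push_cast; ring
      rwa [e, Int.even_add_one, not_not] at he
  · exact subsingleton_HCNegWeight_of_lt k d h

end Vanishing

/-! ### Functions which are multiplied by a sign along the orbits of a map -/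

section Orbits

open Function

variable {k : Type*} [CommRing k] {X I : Type*}

/-- The functions with `f (T u) = ε f u`. -/
def twisted (T : X → X) (ε : k) : Submodule k (X → k) where
  carrier := {f | ∀ u, f (T u) = ε * f u}
  add_mem' {f g} hf hg u := by
    rw [Pi.add_apply, Pi.add_apply, hf u, hg u, mul_add]
  zero_mem' u := by simp
  smul_mem' c f hf u := by
    rw [Pi.smul_apply, Pi.smul_apply, hf u, smul_eq_mul, smul_eq_mul, mul_left_comm]

theorem twisted_iterate {T : X → X} {ε : k} {f : X → k} (hf : f ∈ twisted T ε) (n : ℕ) (u : X) :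
    f (T^[n] u) = ε ^ n * f u := by
  induction n with
  | zero => simp
  | succ n ih => rw [iterate_succ_apply', hf, ih, pow_succ', mul_assoc]

/-- Evaluation at orbit representatives. -/
def evalAt (T : X → X) (ε : k) (c : I → X) : twisted T ε →ₗ[k] (I → k) :=
  LinearMap.funLeft k k c ∘ₗ (twisted T ε).subtype

theorem pow_eq_pow_of_iterate_eq {T : X → X} {N : ℕ} (hN : 0 < N) (hT : ∀ u, T^[N] u = u) {ε : k}
    {u : X} (hε : ε ^ minimalPeriod T u = 1) {m n : ℕ} (h : T^[m] u = T^[n] u) :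
    ε ^ m = ε ^ n := by
  have hp : ∀ j, ε ^ (j % minimalPeriod T u) = ε ^ j := fun j => by
    conv_rhs => rw [← Nat.mod_add_div j (minimalPeriod T u), pow_add, pow_mul, hε, one_pow, mul_one]
  have hpos : 0 < minimalPeriod T u := IsPeriodicPt.minimalPeriod_pos hN (hT u)
  rw [← hp m, ← hp n]
  congr 1
  refine iterate_injOn_Iio_minimalPeriod (f := T) (x := u) (Nat.mod_lt _ hpos) (Nat.mod_lt _ hpos) ?_
  simp only [iterate_mod_minimalPeriod_eq, h]

/-- Going once around an orbit multiplies f by ε to the period. If this is -1 then f = -f = 0 on the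
orbit; if it is 1, the value at the representative can be chosen freely and determines f there. -/
theorem bijective_evalAt [IsDomain k] [CharZero k] {T : X → X} {N : ℕ} (hN : 0 < N) (hT : ∀ u, T^[N] u = u) {ε : k}
    (hε : ε = 1 ∨ ε = -1) (c : I → X) (hc : ∀ i, ε ^ minimalPeriod T (c i) = 1)
    (hinj : ∀ i j m n, T^[m] (c i) = T^[n] (c j) → i = j)
    (hsurj : ∀ u, ε ^ minimalPeriod T u = 1 → ∃ i n, u = T^[n] (c i)) :
    Bijective (evalAt T ε c) := by
  constructor
  · rw [← LinearMap.ker_eq_bot, LinearMap.ker_eq_bot']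
    rintro ⟨f, hf⟩ h
    refine Subtype.ext (funext fun u => ?_)
    change f u = 0
    by_cases hu : ε ^ minimalPeriod T u = 1
    · obtain ⟨i, n, rfl⟩ := hsurj u hu
      have h0 : f (c i) = 0 := congrFun h i
      rw [twisted_iterate hf, h0, mul_zero]
    · have h1 : ε ^ minimalPeriod T u = -1 := by
        rcases hε with rfl | rfl
        · exact absurd (one_pow _) hu
        · exact (neg_one_pow_eq_or k _).resolve_left hu
      have h2 := twisted_iterate hf (minimalPeriod T u) u
      rw [iterate_minimalPeriod, h1, neg_one_mul] at h2
      exact self_eq_neg.mp h2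
  · intro g
    classical
    have hwd : ∀ i j m n, T^[m] (c i) = T^[n] (c j) → ε ^ m * g i = ε ^ n * g j := by
      intro i j m n h
      obtain rfl := hinj i j m n h
      rw [pow_eq_pow_of_iterate_eq hN hT (hc i) h]
    -- The choice of an exponent is harmless by `hwd`; orbits without a representative get the value
    -- zero.
    let f : X → k := fun u =>
      if h : ∃ p : I × ℕ, u = T^[p.2] (c p.1) then ε ^ h.choose.2 * g h.choose.1 else 0
    have hf : ∀ i n, f (T^[n] (c i)) = ε ^ n * g i := by
      intro i n
      have h : ∃ p : I × ℕ, T^[n] (c i) = T^[p.2] (c p.1) := ⟨(i, n), rfl⟩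
      simp only [f, dif_pos h]
      exact (hwd _ _ _ _ h.choose_spec).symm
    refine ⟨⟨f, fun u => ?_⟩, funext fun i => ?_⟩
    · by_cases h : ∃ p : I × ℕ, u = T^[p.2] (c p.1)
      · obtain ⟨⟨i, n⟩, rfl⟩ := h
        simp only
        rw [← iterate_succ_apply' T n, hf, hf, pow_succ', mul_assoc]
      · have h' : ¬ ∃ p : I × ℕ, T u = T^[p.2] (c p.1) := by
          rintro ⟨⟨i, n⟩, hn⟩
          -- T^(N-1) inverts T, so u lies in the orbit whenever T u does.
          refine h ⟨(i, N - 1 + n), ?_⟩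
          simp only at hn ⊢
          rw [iterate_add_apply, ← hn, ← iterate_succ_apply, Nat.succ_eq_add_one,
            Nat.sub_add_cancel hN, hT]
        simp only [f, dif_neg h, dif_neg h', mul_zero]
    · change f (c i) = g i
      simpa using hf i 0

end Orbits

/-! ### Periodic words -/

section PeriodicWords

open Function

variable {m w d : ℕ}

theorem rotWord_apply (v : Fin m → Fin d) (i : Fin m) :
    rotWord v i = v ⟨if (i : ℕ) = 0 then m - 1 else (i : ℕ) - 1, by split_ifs <;> omega⟩ := by
  obtain ⟨n, rfl⟩ : ∃ n, m = n + 1 := ⟨m - 1, by have := i.2; omega⟩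
  rw [rotWord, comp_apply]
  congr 1
  exact Fin.ext (by rw [finRotate_symm_val]; rfl)

theorem rotWord_iterate_apply (v : Fin m → Fin d) (n : ℕ) (i : Fin m) (hn : n ≤ i) :
    rotWord^[n] v i = v ⟨i - n, by omega⟩ := by
  induction n generalizing i with
  | zero => rfl
  | succ n ih =>
    rw [iterate_succ_apply', rotWord_apply, ih _ (by simp only; split_ifs <;> omega)]
    congr 1
    ext
    simp only
    split_ifs <;> omega

theorem rotWord_iterate_length (v : Fin m → Fin d) : rotWord^[m] v = v := by
  funext i
  have hi := i.2
  -- Position i is followed back to 0 in i steps, one step wraps to m - 1, and m - 1 - i further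
  -- steps return to i.
  have e : m = i + ((m - 1 - i) + 1) := by omega
  have h : rotWord^[m] v i = rotWord^[(i : ℕ) + ((m - 1 - i) + 1)] v i := by rw [← e]
  rw [h, iterate_add_apply, rotWord_iterate_apply _ _ _ le_rfl, iterate_succ_apply',
    rotWord_apply, rotWord_iterate_apply _ _ _ (by simp)]
  congr 1
  ext
  simp only [Nat.sub_self, if_true]
  omega

theorem cycleLength_pos (hm : 0 < m) (v : Fin m → Fin d) : 0 < cycleLength v :=
  IsPeriodicPt.minimalPeriod_pos hm (rotWord_iterate_length v)

theorem cycleLength_dvd (v : Fin m → Fin d) : cycleLength v ∣ m :=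
  IsPeriodicPt.minimalPeriod_dvd (rotWord_iterate_length v)

/-- The periodic continuation of a word. -/
def repeatWord (w : ℕ) (hm : 0 < m) (v : Fin m → Fin d) : Fin w → Fin d :=
  fun i => v ⟨i % m, Nat.mod_lt _ hm⟩

theorem rotWord_repeatWord (hm : 0 < m) (hw : m ∣ w) (v : Fin m → Fin d) :
    rotWord (repeatWord w hm v) = repeatWord w hm (rotWord v) := by
  funext i
  rw [rotWord_apply, repeatWord, repeatWord, rotWord_apply]
  congr 1
  ext
  obtain ⟨c, rfl⟩ := hw
  have hi := i.2
  have h1 := Nat.mod_add_div (i : ℕ) m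
  have h2 := Nat.mod_lt (i : ℕ) hm
  simp only
  by_cases hi0 : (i : ℕ) = 0
  · rw [if_pos hi0, hi0, Nat.zero_mod, if_pos rfl]
    obtain ⟨c, rfl⟩ : ∃ c', c = c' + 1 := ⟨c - 1, by
      rcases c with _ | c
      · simp at hi
      · omega⟩
    have e : m * (c + 1) - 1 = (m - 1) + m * c := by rw [mul_add, mul_one]; omega
    rw [e, Nat.add_mul_mod_self_left, Nat.mod_eq_of_lt (by omega)]
  · rw [if_neg hi0]
    by_cases h0 : (i : ℕ) % m = 0
    · rw [if_pos h0]
      obtain ⟨c', hc'⟩ : ∃ c', (i : ℕ) / m = c' + 1 := Nat.exists_eq_succ_of_ne_zero fun h => by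
        rw [h0, h] at h1
        exact hi0 (by simpa using h1.symm)
      have e : (i : ℕ) - 1 = (m - 1) + m * c' := by
        rw [hc', mul_add, mul_one] at h1; omega
      rw [e, Nat.add_mul_mod_self_left, Nat.mod_eq_of_lt (by omega)]
    · rw [if_neg h0]
      have e : (i : ℕ) - 1 = ((i : ℕ) % m - 1) + m * ((i : ℕ) / m) := by
        generalize m * ((i : ℕ) / m) = b at *
        generalize (i : ℕ) % m = a at *
        omega
      rw [e, Nat.add_mul_mod_self_left, Nat.mod_eq_of_lt (by omega)]

theorem rotWord_iterate_repeatWord (hm : 0 < m) (hw : m ∣ w) (n : ℕ) (v : Fin m → Fin d) :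
    rotWord^[n] (repeatWord w hm v) = repeatWord w hm (rotWord^[n] v) := by
  induction n with
  | zero => rfl
  | succ n ih => rw [iterate_succ_apply', ih, rotWord_repeatWord hm hw, iterate_succ_apply']

theorem repeatWord_injective (hm : 0 < m) (hmw : m ≤ w) :
    Injective (repeatWord (d := d) w hm) := by
  intro u v h
  funext i
  have := congrFun h ⟨i, by omega⟩
  simpa [repeatWord, Nat.mod_eq_of_lt i.2] using this

theorem cycleLength_repeatWord (hm : 0 < m) (hw0 : 0 < w) (hw : m ∣ w) (v : Fin m → Fin d) :
    cycleLength (repeatWord w hm v) = cycleLength v := by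
  refine minimalPeriod_eq_minimalPeriod_iff.mpr fun n => ?_
  rw [IsPeriodicPt, IsFixedPt, rotWord_iterate_repeatWord hm hw,
    (repeatWord_injective hm (Nat.le_of_dvd hw0 hw)).eq_iff]
  rfl

/-- The repeated block consists of the first p letters, p the cycle length: invariance under p
rotations gives u(n) = u(n - p) for n ≥ p. -/
theorem exists_repeatWord (hw : 0 < w) (u : Fin w → Fin d) :
    ∃ v : Fin (cycleLength u) → Fin d, repeatWord w (cycleLength_pos hw u) v = u := by
  set p := cycleLength u with hp
  have hpos : 0 < p := cycleLength_pos hw u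
  have hle : p ≤ w := Nat.le_of_dvd hw (cycleLength_dvd u)
  have hrot : rotWord^[p] u = u := iterate_minimalPeriod
  refine ⟨fun j => u ⟨j, by omega⟩, ?_⟩
  have h : ∀ (n : ℕ) (hn : n < w), u ⟨n % p, (Nat.mod_le _ _).trans_lt hn⟩ = u ⟨n, hn⟩ := by
    intro n
    induction n using Nat.strong_induction_on with
    | _ n ih =>
      intro hn
      rcases lt_or_ge n p with h | h
      · congr 1
        exact Fin.ext (Nat.mod_eq_of_lt h)
      · have h1 := rotWord_iterate_apply u p ⟨n, hn⟩ h
        rw [hrot] at h1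
        rw [h1, ← ih (n - p) (by omega) (by omega)]
        congr 1
        exact Fin.ext (Nat.mod_eq_sub_mod h)
  funext i
  exact h i i.2

theorem mem_cycleFamily_self (v : Fin m → Fin d) : v ∈ cycleFamily v := ⟨0, rfl⟩

theorem cycleFamily_eq_of_iterate_eq {u v : Fin m → Fin d} {a b : ℕ}
    (h : rotWord^[a] u = rotWord^[b] v) : cycleFamily u = cycleFamily v := by
  rcases Nat.eq_zero_or_pos m with rfl | hm
  · rw [Subsingleton.elim u v]
  have key : ∀ {u v : Fin m → Fin d} {a b : ℕ}, rotWord^[a] u = rotWord^[b] v →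
      cycleFamily u ⊆ cycleFamily v := by
    rintro u v a b h _ ⟨n, rfl⟩
    refine ⟨n + a * (m - 1) + b, ?_⟩
    -- Together these are a·m rotations, which act trivially.
    have hu : rotWord^[a * (m - 1)] (rotWord^[a] u) = u := by
      rw [← iterate_add_apply, ← Nat.mul_succ, Nat.succ_eq_add_one, Nat.sub_add_cancel hm]
      exact (IsPeriodicPt.const_mul (rotWord_iterate_length u) a)
    rw [iterate_add_apply, ← h, iterate_add_apply, hu]
  exact (key h).antisymm (key h.symm)

theorem cycleFamily_eq_of_mem {u v : Fin m → Fin d} (h : u ∈ cycleFamily v) :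
    cycleFamily u = cycleFamily v := by
  obtain ⟨n, rfl⟩ := h
  exact cycleFamily_eq_of_iterate_eq (a := 0) (b := n) rfl

theorem cycleLength_eq_of_mem (hm : 0 < m) {u v : Fin m → Fin d} (h : u ∈ cycleFamily v) :
    cycleLength u = cycleLength v := by
  obtain ⟨n, rfl⟩ := h
  exact minimalPeriod_apply_iterate (mk_mem_periodicPts hm (rotWord_iterate_length v)) n

/-! ### Counting cycle families -/

theorem card_cycleFamily (hm : 0 < m) (v : Fin m → Fin d) :
    Nat.card (cycleFamily v) = cycleLength v := by
  have e : cycleFamily v = (fun n => rotWord^[n] v) '' Set.Iio (cycleLength v) := by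
    ext u
    constructor
    · rintro ⟨n, rfl⟩
      exact ⟨n % cycleLength v, Nat.mod_lt _ (cycleLength_pos hm v), iterate_mod_minimalPeriod_eq⟩
    · rintro ⟨n, -, rfl⟩
      exact ⟨n, rfl⟩
  have hinj : Set.InjOn (fun n => rotWord^[n] v) (Set.Iio (cycleLength v)) :=
    iterate_injOn_Iio_minimalPeriod
  rw [Nat.card_coe_set_eq, e, hinj.ncard_image,
    ← Finset.coe_Iio, Set.ncard_coe_finset, Nat.card_Iio]

/-- The words of length `m` and cycle length `m` are divided into families of `m` words. -/
theorem card_primitive (hm : 0 < m) :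
    Nat.card {v : Fin m → Fin d // cycleLength v = m} = m * Nat.card (omega m d) := by
  have e : Nat.card (Σ F : omega m d, F.1) = Nat.card {v : Fin m → Fin d // cycleLength v = m} := by
    refine Nat.card_congr (Equiv.ofBijective (fun p => ⟨p.2.1, ?_⟩) ⟨?_, ?_⟩)
    · obtain ⟨⟨F, v, hv, rfl⟩, u, hu⟩ := p
      rw [cycleLength_eq_of_mem hm hu, hv]
    · rintro ⟨⟨F, v, hv, rfl⟩, u, hu⟩ ⟨⟨F', v', hv', rfl⟩, u', hu'⟩ h
      obtain rfl : u = u' := congrArg Subtype.val h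
      have h1 : cycleFamily v = cycleFamily v' := by
        rw [← cycleFamily_eq_of_mem hu, ← cycleFamily_eq_of_mem hu']
      exact Sigma.subtype_ext (Subtype.ext h1) rfl
    · rintro ⟨v, hv⟩
      exact ⟨⟨⟨cycleFamily v, v, hv, rfl⟩, v, mem_cycleFamily_self v⟩, rfl⟩
  have hfin : Fintype (omega m d) := Fintype.ofFinite _
  rw [← e, Nat.card_sigma, Finset.sum_congr rfl (g := fun _ => m), Finset.sum_const,
    Finset.card_univ, smul_eq_mul, mul_comm, Nat.card_eq_fintype_card]
  rintro ⟨F, v, hv, rfl⟩ -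
  exact (card_cycleFamily hm v).trans hv

/-- Every word of length w is, in exactly one way, the repetition of a word of length i whose cycle
length is i, with i a divisor of w. -/
theorem sum_divisors_card_omega (hw : 0 < w) :
    ∑ i ∈ w.divisors, i * Nat.card (omega i d) = d ^ w := by
  have e : Nat.card (Σ i : w.divisors, {v : Fin i.1 → Fin d // cycleLength v = i.1}) =
      Nat.card (Fin w → Fin d) := by
    refine Nat.card_congr (Equiv.ofBijective
      (fun p => repeatWord w (Nat.pos_of_mem_divisors p.1.2) p.2.1) ⟨?_, ?_⟩)
    · rintro ⟨⟨i, hi⟩, u, hu⟩ ⟨⟨j, hj⟩, v, hv⟩ h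
      simp only at h
      have hi' := Nat.pos_of_mem_divisors hi
      have hj' := Nat.pos_of_mem_divisors hj
      have hij : i = j := by
        have hu' := cycleLength_repeatWord hi' hw (Nat.dvd_of_mem_divisors hi) u
        have hv' := cycleLength_repeatWord hj' hw (Nat.dvd_of_mem_divisors hj) v
        exact hu.symm.trans (hu'.symm.trans ((congrArg cycleLength h).trans (hv'.trans hv)))
      subst hij
      obtain rfl : u = v := repeatWord_injective hi' (Nat.divisor_le hi) h
      rfl
    · intro u
      obtain ⟨v, hv⟩ := exists_repeatWord hw u
      refine ⟨⟨⟨cycleLength u, Nat.mem_divisors.mpr ⟨cycleLength_dvd u, hw.ne'⟩⟩, v, ?_⟩, hv⟩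
      rw [← cycleLength_repeatWord (cycleLength_pos hw u) hw (cycleLength_dvd u), hv]
  rw [Nat.card_sigma, Nat.card_eq_fintype_card (α := Fin w → Fin d)] at e
  simp only [Fintype.card_fun, Fintype.card_fin] at e
  rw [← e, ← Finset.sum_coe_sort w.divisors]
  exact Finset.sum_congr rfl fun i _ => (card_primitive (Nat.pos_of_mem_divisors i.2)).symm

theorem card_omega (hm : 0 < m) : (Nat.card (omega m d) : ℚ) =
    1 / m * ∑ i ∈ m.divisors, (ArithmeticFunction.moebius (m / i) : ℚ) * (d : ℚ) ^ i := by
  have h := (ArithmeticFunction.sum_eq_iff_sum_mul_moebius_eq (R := ℚ)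
    (f := fun i => (i * Nat.card (omega i d) : ℕ)) (g := fun i => (d : ℚ) ^ i)).mp
    (fun n hn => by
      rw [← Nat.cast_sum, sum_divisors_card_omega hn, Nat.cast_pow]) m hm
  rw [← Nat.sum_divisorsAntidiagonal' fun i j =>
    (ArithmeticFunction.moebius i : ℚ) * (d : ℚ) ^ j, h]
  have : (m : ℚ) ≠ 0 := Nat.cast_ne_zero.mpr hm.ne'
  push_cast
  field_simp

end PeriodicWords

/-! ### The invariants of the signed rotation -/

section Invariants

open Function

section CommRing

variable (k : Type*) [CommRing k] (d : ℕ)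

/-- The coefficients of a chain at the words without units. -/
def letterCoeff (r : ℕ) : Chain k (Trunc k d) r →ₗ[k] ((Fin (r + 1) → Fin d) → k) :=
  LinearMap.pi fun v => (chainBasis k d r).coord (some ∘ v)

/-- The chain with given coefficients at the words without units. -/
def ofLetterCoeff (r : ℕ) (f : (Fin (r + 1) → Fin d) → k) : Chain k (Trunc k d) r :=
  ∑ v, f v • chainBasis k d r (some ∘ v)

theorem letterCoeff_chainBasis_some (r : ℕ) (v : Fin (r + 1) → Fin d) :
    letterCoeff k d r (chainBasis k d r (some ∘ v)) = Pi.single v 1 := by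
  funext v'
  simp only [letterCoeff, LinearMap.pi_apply, Module.Basis.coord_apply, Module.Basis.repr_self]
  by_cases h : v = v'
  · subst h; simp
  · rw [Pi.single_eq_of_ne (Ne.symm h), Finsupp.single_eq_of_ne]
    exact fun h' => h ((Option.some_injective _).comp_left h').symm

theorem letterCoeff_ofLetterCoeff (r : ℕ) (f : (Fin (r + 1) → Fin d) → k) :
    letterCoeff k d r (ofLetterCoeff k d r f) = f := by
  rw [ofLetterCoeff, map_sum]
  simp only [map_smul, letterCoeff_chainBasis_some]
  funext v
  simp [Finset.sum_apply, Pi.single_apply]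

theorem ofLetterCoeff_mem_weightPart (r : ℕ) (f : (Fin (r + 1) → Fin d) → k) :
    ofLetterCoeff k d r f ∈ weightPart k d (r + 1) r := by
  refine Submodule.sum_mem _ fun v _ => Submodule.smul_mem _ _ ?_
  rw [weightPart_eq_span]
  exact Submodule.subset_span ⟨_, (wordWeight_eq_iff _).mpr fun i => by simp, rfl⟩

theorem eq_zero_of_letterCoeff_eq_zero {r : ℕ} {x : Chain k (Trunc k d) r}
    (hx : x ∈ weightPart k d (r + 1) r) (h : letterCoeff k d r x = 0) : x = 0 := by
  rw [weightPart_eq_span, Module.Basis.mem_span_image] at hx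
  refine (chainBasis k d r).ext_elem fun u => ?_
  rw [map_zero, Finsupp.zero_apply]
  by_contra hne
  have hu := (wordWeight_eq_iff u).mp (hx (Finsupp.mem_support_iff.mpr hne))
  choose v hv using fun i => Option.ne_none_iff_exists'.mp (hu i)
  obtain rfl : u = some ∘ v := funext hv
  exact hne (congrFun h v)

/-- Rotating the basis permutes the coefficients; this is what turns invariance under t into the
condition defining `twisted`. -/
theorem letterCoeff_tMap (r : ℕ) (x : Chain k (Trunc k d) r) (v : Fin (r + 1) → Fin d) :
    letterCoeff k d r (tMap k (Trunc k d) r x) (rotWord v) =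
      (-1) ^ r * letterCoeff k d r x v := by
  suffices h : LinearMap.proj (rotWord v) ∘ₗ letterCoeff k d r ∘ₗ rot k (Trunc k d) r =
      LinearMap.proj v ∘ₗ letterCoeff k d r by
    have := LinearMap.congr_fun h x
    simp only [LinearMap.comp_apply, LinearMap.proj_apply] at this
    rw [tMap, LinearMap.smul_apply, map_smul, Pi.smul_apply, smul_eq_mul, this]
  refine (chainBasis k d r).ext fun u => ?_
  simp only [LinearMap.comp_apply, LinearMap.proj_apply, rot_chainBasis, letterCoeff,
    LinearMap.pi_apply, Module.Basis.coord_apply, Module.Basis.repr_self]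
  rw [Finsupp.single_apply, Finsupp.single_apply]
  have e : ((fun i => u ((finRotate (r + 1)).symm i)) = some ∘ rotWord v) ↔ u = some ∘ v :=
    (finRotate (r + 1)).symm.surjective.injective_comp_right.eq_iff
      (a := u) (b := some ∘ v)
  simp only [e]

theorem tMap_eq_self_iff {r : ℕ} {x : Chain k (Trunc k d) r}
    (hx : x ∈ weightPart k d (r + 1) r) :
    tMap k (Trunc k d) r x = x ↔ letterCoeff k d r x ∈ twisted rotWord ((-1) ^ r : k) := by
  constructor
  · intro h v
    rw [← letterCoeff_tMap, h]
  · intro h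
    refine sub_eq_zero.mp (eq_zero_of_letterCoeff_eq_zero k d
      (Submodule.sub_mem _ (tMap_mem_weightPart k d _ _ hx) hx) (funext fun v => ?_))
    -- Every word is a rotation of another one, so it suffices to compare coefficients at rotated
    -- words.
    have hv : rotWord (rotWord^[r] v) = v := by
      rw [← iterate_succ_apply' rotWord]; exact rotWord_iterate_length v
    rw [← hv, map_sub, Pi.sub_apply, letterCoeff_tMap, h, sub_self, Pi.zero_apply]

/-- The invariants of the signed rotation as functions on words. -/
def cyclicInvariantsEquiv (r : ℕ) : cyclicInvariants k d r ≃ₗ[k]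
    twisted (rotWord (m := r + 1) (d := d)) ((-1) ^ r : k) :=
  LinearEquiv.ofBijective
    ((letterCoeff k d r ∘ₗ (cyclicInvariants k d r).subtype).codRestrict _ fun x =>
      (tMap_eq_self_iff k d x.2.2).mp (sub_eq_zero.mp x.2.1).symm) <| by
    constructor
    · rw [← LinearMap.ker_eq_bot, LinearMap.ker_eq_bot']
      intro x hx
      exact Subtype.ext (eq_zero_of_letterCoeff_eq_zero k d x.2.2 (congrArg Subtype.val hx))
    · rintro ⟨f, hf⟩
      have hS := ofLetterCoeff_mem_weightPart k d r f
      have hc := letterCoeff_ofLetterCoeff k d r f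
      refine ⟨⟨ofLetterCoeff k d r f, sub_eq_zero.mpr ?_, hS⟩, Subtype.ext hc⟩
      exact ((tMap_eq_self_iff k d hS).mpr (by rwa [hc])).symm

end CommRing

variable (k : Type*) [Field k] [CharZero k] (d : ℕ)

/-- The condition is that rm is even. For odd r this says m is even; for even r it always holds, and
then m is odd as a divisor of r + 1. -/
theorem sign_pow_eq_one_iff {r m : ℕ} (hm : m ∣ r + 1) :
    (((-1) ^ r : k)) ^ m = 1 ↔ m ≡ r + 1 [MOD 2] := by
  have h1 : (-1 : k) ≠ 1 := by norm_num
  rw [← pow_mul, neg_one_pow_eq_one_iff_even h1, Nat.even_mul]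
  have h2 : ¬ Even (r + 1) → ¬ Even m := fun h he => h (he.trans_dvd hm)
  rw [Nat.ModEq]
  simp only [Nat.even_iff] at h2 ⊢
  omega

/-- Representatives of the cycle families of the words of length `w` on which rotation acts
without sign. -/
def familyRep (w : ℕ) (hw : 0 < w)
    (i : Σ m : {m : ℕ // m ∣ w ∧ m ≡ w [MOD 2]}, omega m.1 d) : Fin w → Fin d :=
  repeatWord w (Nat.pos_of_dvd_of_pos i.1.2.1 hw) i.2.2.choose

/-- Repeating words preserves cycle length and commutes with rotation, so the families in ω_{m,d},
for the admitted m, index exactly the orbits on which the sign is trivial. -/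
theorem bijective_evalAt_familyRep (r : ℕ) :
    Bijective (evalAt (rotWord (m := r + 1) (d := d)) ((-1) ^ r : k)
      (familyRep d (r + 1) (Nat.succ_pos r))) := by
  have hlen : ∀ i, minimalPeriod rotWord (familyRep d (r + 1) (Nat.succ_pos r) i) = i.1.1 :=
    fun i => (cycleLength_repeatWord _ (Nat.succ_pos r) i.1.2.1 _).trans i.2.2.choose_spec.1
  refine bijective_evalAt (Nat.succ_pos r) rotWord_iterate_length (neg_one_pow_eq_or k r) _
    (fun i => ?_) ?_ fun u hu => ?_
  · rw [hlen, sign_pow_eq_one_iff k i.1.2.1]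
    exact i.1.2.2
  · intro i j a b h
    have hij : i.1.1 = j.1.1 := by
      rw [← hlen i, ← hlen j]
      have h1 := cycleLength_eq_of_mem (Nat.succ_pos r)
        (u := rotWord^[a] (familyRep d (r + 1) (Nat.succ_pos r) i)) ⟨a, rfl⟩
      have h2 := cycleLength_eq_of_mem (Nat.succ_pos r)
        (u := rotWord^[b] (familyRep d (r + 1) (Nat.succ_pos r) j)) ⟨b, rfl⟩
      exact h1.symm.trans ((congrArg cycleLength h).trans h2)
    obtain ⟨⟨m, hm⟩, F⟩ := i
    obtain ⟨⟨m', hm'⟩, F'⟩ := j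
    obtain rfl : m = m' := hij
    have hpos := Nat.pos_of_dvd_of_pos hm.1 (Nat.succ_pos r)
    simp only [familyRep] at h
    rw [rotWord_iterate_repeatWord hpos hm.1, rotWord_iterate_repeatWord hpos hm.1] at h
    have h3 := cycleFamily_eq_of_iterate_eq
      (repeatWord_injective hpos (Nat.le_of_dvd (Nat.succ_pos r) hm.1) h)
    obtain rfl : F = F' := Subtype.ext
      (F.2.choose_spec.2.trans (h3.trans F'.2.choose_spec.2.symm))
    rfl
  · obtain ⟨v, hv⟩ := exists_repeatWord (Nat.succ_pos r) u
    have hdvd := cycleLength_dvd u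
    have hvl : cycleLength v = cycleLength u := by
      rw [← cycleLength_repeatWord (cycleLength_pos (Nat.succ_pos r) u) (Nat.succ_pos r) hdvd, hv]
    let F : omega (cycleLength u) d := ⟨cycleFamily v, v, hvl, rfl⟩
    refine ⟨⟨⟨cycleLength u, hdvd, (sign_pow_eq_one_iff k hdvd).mp hu⟩, F⟩, ?_⟩
    -- The representative chosen for the family need not be v itself, only a rotation of it.
    have hmem : v ∈ cycleFamily F.2.choose := by
      rw [← F.2.choose_spec.2]; exact mem_cycleFamily_self v
    obtain ⟨n, hn⟩ := hmem
    refine ⟨n, ?_⟩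
    rw [familyRep, rotWord_iterate_repeatWord _ hdvd]
    conv_lhs => rw [← hv, hn]

/-- Both index sets are finite, so functions on orbit representatives form the iterated direct sum.
-/
theorem nonempty_cyclicInvariants_equiv (r : ℕ) : Nonempty (cyclicInvariants k d r ≃ₗ[k]
    DirectSum {m : ℕ // m ∣ r + 1 ∧ m ≡ r + 1 [MOD 2]} fun m =>
      DirectSum (omega m.1 d) fun _ => k) := by
  classical
  have : Finite {m : ℕ // m ∣ r + 1 ∧ m ≡ r + 1 [MOD 2]} :=
    Set.Finite.subset (Set.finite_Iic (r + 1)) fun m hm => Nat.le_of_dvd (Nat.succ_pos r) hm.1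
  have : Fintype _ := Fintype.ofFinite {m : ℕ // m ∣ r + 1 ∧ m ≡ r + 1 [MOD 2]}
  have : ∀ m, Fintype (omega m d) := fun m => Fintype.ofFinite _
  exact ⟨(cyclicInvariantsEquiv k d r).trans <|
    (LinearEquiv.ofBijective _ (bijective_evalAt_familyRep k d r)).trans <|
    (LinearEquiv.piCurry k fun (m : {m : ℕ // m ∣ r + 1 ∧ m ≡ r + 1 [MOD 2]})
      (_ : omega m.1 d) => k).trans <|
    (LinearEquiv.piCongrRight fun m =>
      (DirectSum.linearEquivFunOnFintype k (omega m.1 d) fun _ => k).symm).trans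
    (DirectSum.linearEquivFunOnFintype k _ fun m : {m : ℕ // m ∣ r + 1 ∧ m ≡ r + 1 [MOD 2]} =>
      DirectSum (omega m.1 d) fun _ => k).symm⟩

end Invariants

end NegCyc

end

theorem mainTheorem8 (d : ℕ) :
    -- weight zero
    (∀ n : ℤ, (Even n ∧ n ≤ 0 → Nonempty (NegCyc.HCNegWeight ℚ d 0 n ≃ₗ[ℚ] ℚ)) ∧
      (¬ (Even n ∧ n ≤ 0) → Subsingleton (NegCyc.HCNegWeight ℚ d 0 n))) ∧
    -- positive weight
    (∀ w : ℕ, 0 < w → ∀ n : ℤ,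
      (n = w → Nonempty (NegCyc.HCNegWeight ℚ d w n ≃ₗ[ℚ]
        DirectSum {m : ℕ // m ∣ w ∧ m ≡ w [MOD 2]} fun m =>
          DirectSum (NegCyc.omega m.1 d) fun _ => ℚ)) ∧
      (n ≠ w → Subsingleton (NegCyc.HCNegWeight ℚ d w n))) ∧
    -- the number of cycle families
    (∀ m : ℕ, 0 < m → (Nat.card (NegCyc.omega m d) : ℚ) =
      1 / m * ∑ i ∈ m.divisors, (ArithmeticFunction.moebius (m / i) : ℚ) * (d : ℚ) ^ i) := by
  refine ⟨fun n => ⟨fun h => NegCyc.nonempty_HCNegWeight_zero_equiv ℚ d h.1 h.2,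
    fun h => NegCyc.subsingleton_HCNegWeight_zero ℚ d h⟩,
    fun w hw n => ⟨?_, fun h => NegCyc.subsingleton_HCNegWeight_of_ne ℚ d hw h⟩,
    fun m hm => NegCyc.card_omega hm⟩
  rintro rfl
  obtain ⟨r, rfl⟩ : ∃ r, w = r + 1 := ⟨w - 1, by omega⟩
  obtain ⟨e₁⟩ := NegCyc.nonempty_HCNegWeight_equiv_cyclicInvariants ℚ d r
  obtain ⟨e₂⟩ := NegCyc.nonempty_cyclicInvariants_equiv ℚ d r
  exact ⟨e₁.trans e₂⟩
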